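/- Let $\eta,\lambda,\mu\in\mathbb C$ and $n\ge 1$. **20V model with DWBC2.** Consider the nodes $(i,j)$, $1\le i,j\le n$, of the triangular lattice: each node has the six incident edges West, Northwest, North (by which paths arrive) and East, Southeast, South (by which paths leave), an edge being horizontal, vertical, or a second diagonal $(i,j+1)\to(i+1,j)$. A configuration is a set of occupied edges such that at each node as many incoming as outgoing edges are occupied (ice rule), all the edges of the left and bottom boundaries except the upper left and the lower right diagonal ones are occupied, and all the other boundary edges are unoccupied. Its weight is the product over the nodes of the following node weights. An empty node and a node with all six edges occupied have weight $\omega_0$. A node with exactly one incoming and one outgoing occupied edge has weight $$\omega_6\ (W\to E),\quad \omega_5\ (W\to SE,\ NW\to E),\quad \omega_4\ (W\to S,\ N\to E),\quad \omega_3\ (NW\to SE),\quad \omega_2\ (NW\to S,\ N\to SE),\quad \omega_1\ (N\to S),$$ and a node with two incoming and two outgoing occupied edges has the weight of the complementary node (occupied and unoccupied edges exchanged). Here $$\begin{aligned} \omega_0&=\sin(\lambda+\eta)\sin\tfrac{\lambda+3\eta+\mu}{2}\sin\tfrac{\lambda+3\eta-\mu}{2},& \omega_1&=\sin(\lambda-\eta)\sin\tfrac{\lambda-\eta+\mu}{2}\sin\tfrac{\lambda+3\eta-\mu}{2},\\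 \omega_2&=\sin(2\eta)\sin(\lambda-\eta)\sin\tfrac{\lambda+3\eta-\mu}{2},& \omega_3&=\sin(2\eta)^3+\sin(\lambda+\eta)\sin\tfrac{\lambda-\eta+\mu}{2}\sin\tfrac{\lambda-\eta-\mu}{2},\\ \omega_4&=\sin(2\eta)\sin\tfrac{\lambda+3\eta+\mu}{2}\sin\tfrac{\lambda+3\eta-\mu}{2},& \omega_5&=\sin(2\eta)\sin(\lambda-\eta)\sin\tfrac{\lambda+3\eta+\mu}{2},\\ \omega_6&=\sin(\lambda-\eta)\sin\tfrac{\lambda+3\eta+\mu}{2}\sin\tfrac{\lambda-\eta-\mu}{2}.&& \end{aligned}$$ At each node the $k$-th occupied incoming edge from the top (order N, NW, W) is continued by the $k$-th occupied outgoing edge from the top (order E, SE, S); this decomposes a configuration into osculating paths. The uppermost path is the one that starts with the edge $(0,n)\to(1,n)$. It hits the right boundary, i.e. the line of abscissa $n$, at the first node $(n,L)$ of this line that it visits, and its step just before is horizontal or diagonal. Let $Z^{-}_{n;L}$ and $Z^{\diagdown}_{n;L}$ be the sums of the weights of the configurations for which the hitting point is $(n,L)$ and the step before it is horizontal, respectively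 diagonal, and set $$Z^{-}_n(\tau)=\sum_{L=1}^n Z^{-}_{n;L}\,\tau^{L-1},\qquad Z^{\diagdown}_n(\tau)=\sum_{L=1}^n Z^{\diagdown}_{n;L}\,\tau^{L-1}.$$ **6V model with DWBC.** In the same way, without diagonal edges: the horizontal edges of the left boundary and the vertical edges of the bottom boundary are occupied, the other boundary edges are unoccupied, and the ice rule holds at each node. The weight of a node is $a=\sin(\lambda+\eta)$ if it is empty or full, $b=\sin(\lambda-\eta)$ if exactly its two horizontal or its two vertical edges are occupied, and $c=\sin(2\eta)$ in the two remaining cases. Let $Z^{6V}_{n;L}$ be the sum of the weights of the configurations whose uppermost path hits the right boundary at $(n,L)$, and $Z^{6V}_n(\sigma)=\sum_{L=1}^n Z^{6V}_{n;L}\,\sigma^{L-1}$. **Theorem.** Let $q=e^{i\eta}$, $z=e^{i(\eta+\lambda)}$, $w=e^{-i(\eta+\lambda)}$, $t=e^{i\mu}$, $t^{1/3}=e^{i\mu/3}$, $\nu=1/(2i\,t^{1/3})$, $a_2=\nu(qz-q^{-1}t)$, $a_3=\nu(qt-q^{-1}w)$. Let $\sigma\in\mathbb C$ be such that $$D(\sigma)=\sigma\sin(\lambda-\eta)\sin\tfrac{\lambda-\eta-\mu}{2}-\sin(\lambda+\eta)\sin\tfrac{\lambda-5\eta-\mu}{2}\neq0,$$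 and assume $\sin\tfrac{\lambda-\eta+\mu}{2}\neq0$ (this is automatic for real angles with $0<\eta<\lambda<\pi-\eta$ and $\eta-\lambda<\mu<\lambda-\eta$). Then $$Z^{-}_n(\tau)+g(\sigma)\,Z^{\diagdown}_n(\tau)=\Big(\frac{a_2a_3}{t^{1/3}}\Big)^{n^2}Z^{6V}_n(\sigma),$$ where $$\tau=\sigma\,\frac{\sigma\sin(\lambda-\eta)\sin\frac{\lambda+3\eta-\mu}{2}-\sin(\lambda+\eta)\sin\frac{\lambda-\eta-\mu}{2}}{D(\sigma)}\cdot\frac{\sin\frac{\lambda+3\eta+\mu}{2}}{\sin\frac{\lambda-\eta+\mu}{2}},\qquad g(\sigma)=\frac{\sigma\sin(2\eta)\sin\frac{\lambda+3\eta+\mu}{2}}{D(\sigma)}.$$ -/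

import Mathlib

namespace TwentyVertex

/-- The three kinds of steps of an osculating path: horizontal `(1, 0)`, diagonal `(1, -1)`
and vertical `(0, -1)`. -/
inductive Step
  | hor
  | diag
  | vert
  deriving DecidableEq

/-- The local environment of a node: which of its six incident edges carry a path step.
`inc hor`, `inc diag`, `inc vert` are the edges to the West, Northwest and North of the node (by
which paths arrive); `out hor`, `out diag`, `out vert` are the edges to the East, Southeast and
South (by which paths leave). In terms of arrows, an edge carries a path step when it is oriented
from North, Northwest or West to East, Southeast or South. -/
structure Vertex where
  inc : Step → Bool
  out : Step → Bool

/-- The ice rule: as many ingoing as outgoing arrows at the node. An ingoing arrow is an occupied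
edge of `inc` or an unoccupied edge of `out`, so the rule says that as many path steps arrive at
the node as leave it. -/
def Vertex.Ice (u : Vertex) : Prop :=
  (u.inc .hor).toNat + (u.inc .diag).toNat + (u.inc .vert).toNat
    = (u.out .hor).toNat + (u.out .diag).toNat + (u.out .vert).toNat

/-- The number of occupied incoming edges above the incoming edge `s`
(from top to bottom: North, Northwest, West). -/
def Vertex.incAbove (u : Vertex) : Step → ℕ
  | .vert => 0
  | .diag => (u.inc .vert).toNat
  | .hor => (u.inc .vert).toNat + (u.inc .diag).toNat

/-- The number of occupied outgoing edges above the outgoing edge `t`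
(from top to bottom: East, Southeast, South). -/
def Vertex.outAbove (u : Vertex) : Step → ℕ
  | .hor => 0
  | .diag => (u.out .hor).toNat
  | .vert => (u.out .hor).toNat + (u.out .diag).toNat

/-- The path that arrives by the incoming edge `s` leaves by the outgoing edge `t`. The steps at a
node are concatenated in the unique non-crossing way: the `k`-th occupied incoming edge from the
top is continued by the `k`-th occupied outgoing edge from the top. -/
def Vertex.Linked (u : Vertex) (s t : Step) : Prop :=
  u.inc s = true ∧ u.out t = true ∧ u.incAbove s = u.outAbove t

/-- An assignment of path steps (`true` = occupied) to the edges of the `n × n` portion of the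
triangular lattice. The node `(x, y) : Fin n × Fin n` has coordinates `(x + 1, y + 1)`, the first
one growing to the right and the second one upwards. With these coordinates,
* `h i y` is the horizontal edge from `(i, y + 1)` to `(i + 1, y + 1)`;
* `v x j` is the vertical edge from `(x + 1, j + 1)` to `(x + 1, j)`;
* `d i j` is the diagonal edge from `(i, j + 1)` to `(i + 1, j)`.
The indices `d 0 0` and `d n n` do not correspond to edges (they touch no node). -/
@[ext]
structure EdgeConfig (n : ℕ) where
  h : Fin (n + 1) → Fin n → Bool
  v : Fin n → Fin (n + 1) → Bool
  d : Fin (n + 1) → Fin (n + 1) → Bool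

namespace EdgeConfig

variable {n : ℕ}

/-- An edge configuration is just a triple of functions. -/
def equivProd (n : ℕ) : EdgeConfig n ≃
    (Fin (n + 1) → Fin n → Bool) × (Fin n → Fin (n + 1) → Bool) ×
      (Fin (n + 1) → Fin (n + 1) → Bool) where
  toFun c := (c.h, c.v, c.d)
  invFun p := ⟨p.1, p.2.1, p.2.2⟩
  left_inv _ := rfl
  right_inv _ := rfl

instance instFintype (n : ℕ) : Fintype (EdgeConfig n) :=
  Fintype.ofEquiv _ (equivProd n).symm

/-- The environment of the node `(x, y)`. -/
def vertex (c : EdgeConfig n) (x y : Fin n) : Vertex where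
  inc
    | .hor => c.h x.castSucc y
    | .diag => c.d x.castSucc y.succ
    | .vert => c.v x y.succ
  out
    | .hor => c.h x.succ y
    | .diag => c.d x.succ y.castSucc
    | .vert => c.v x y.castSucc

/-- The boundary conditions of the horizontal and vertical edges: occupied on the left and bottom
boundaries, unoccupied on the right and top boundaries. In terms of arrows: horizontal boundary
edges point towards the square, vertical ones away from it. -/
structure SquareDWBC (c : EdgeConfig n) : Prop where
  left : ∀ y, c.h 0 y = true
  right : ∀ y, c.h (Fin.last n) y = false
  bottom : ∀ x, c.v x 0 = true
  top : ∀ x, c.v x (Fin.last n) = false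

/-- A configuration of the 20V model with domain wall boundary conditions DWBC2: the ice rule holds
at every node, all left and bottom boundary edges are occupied except the upper left and the lower
right diagonal ones, and all the other boundary edges are unoccupied. The two indices of `d` that
are not edges get the value `false`. -/
structure IsTwentyV (c : EdgeConfig n) : Prop where
  ice : ∀ x y, (c.vertex x y).Ice
  square : c.SquareDWBC
  left_diag : ∀ j, j ≠ 0 → j ≠ Fin.last n → c.d 0 j = true
  bottom_diag : ∀ i, i ≠ 0 → i ≠ Fin.last n → c.d i 0 = true
  right_diag : ∀ j, c.d (Fin.last n) j = false
  top_diag : ∀ i, c.d i (Fin.last n) = false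
  corner : c.d 0 0 = false

/-- A configuration of the 6V model with domain wall boundary conditions. The square lattice has no
diagonal edges, so no diagonal is occupied. -/
structure IsSixV (c : EdgeConfig n) : Prop where
  ice : ∀ x y, (c.vertex x y).Ice
  square : c.SquareDWBC
  no_diag : ∀ i j, c.d i j = false

end EdgeConfig

/-- The step `t` leads from the node `(x, y)` to the node `(x', y')`. -/
def Step.Leads {n : ℕ} (t : Step) (x y x' y' : Fin n) : Prop :=
  match t with
  | .hor => x'.val = x.val + 1 ∧ y' = y
  | .diag => x'.val = x.val + 1 ∧ y'.val + 1 = y.val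
  | .vert => x' = x ∧ y'.val + 1 = y.val

/-- `c.UppermostEnters x y s`: the uppermost path, which starts with the highest horizontal edge of
the left boundary and is continued at every node by `Vertex.Linked`, arrives at the node `(x, y)`
by a step `s`. -/
inductive EdgeConfig.UppermostEnters {n : ℕ} (c : EdgeConfig n) : Fin n → Fin n → Step → Prop
  | start (x y : Fin n) : x.val = 0 → y.val + 1 = n → c.h x.castSucc y = true →
      UppermostEnters c x y .hor
  | next (x y : Fin n) (s t : Step) (x' y' : Fin n) : UppermostEnters c x y s →
      (c.vertex x y).Linked s t → t.Leads x y x' y' → UppermostEnters c x' y' t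

/-- The uppermost path hits the line of the last column at the node of height `y` by a step `s`.
The node where a path hits the line is the first one on it, that is, the one that it does not enter
by a vertical step. -/
def EdgeConfig.HitsRight {n : ℕ} (c : EdgeConfig n) (y : Fin n) (s : Step) : Prop :=
  s ≠ .vert ∧ ∃ x : Fin n, x.val + 1 = n ∧ c.UppermostEnters x y s

/-- The weight of a node of the 20V model with weights `ω 0, …, ω 6`. The six arguments tell
whether the edges West, Northwest, North | East, Southeast, South are occupied. -/
def weight20 (ω : Fin 7 → ℂ) : Bool → Bool → Bool → Bool → Bool → Bool → ℂ
  -- no path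
  | false, false, false, false, false, false => ω 0
  -- one path
  | true, false, false, true, false, false => ω 6
  | true, false, false, false, true, false => ω 5
  | true, false, false, false, false, true => ω 4
  | false, true, false, true, false, false => ω 5
  | false, true, false, false, true, false => ω 3
  | false, true, false, false, false, true => ω 2
  | false, false, true, true, false, false => ω 4
  | false, false, true, false, true, false => ω 2
  | false, false, true, false, false, true => ω 1
  -- two paths: the complements of the preceding nine
  | false, true, true, false, true, true => ω 6
  | false, true, true, true, false, true => ω 5
  | false, true, true, true, true, false => ω 4
  | true, false, true, false, true, true => ω 5
  | true, false, true, true, false, true => ω 3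
  | true, false, true, true, true, false => ω 2
  | true, true, false, false, true, true => ω 4
  | true, true, false, true, false, true => ω 2
  | true, true, false, true, true, false => ω 1
  -- three paths
  | true, true, true, true, true, true => ω 0
  -- the ice rule is violated
  | _, _, _, _, _, _ => 0

/-- The weight of a node of the 6V model with weights `a, b, c`. The four arguments tell whether
the edges West, North | East, South are occupied. -/
def weight6 (a b c : ℂ) : Bool → Bool → Bool → Bool → ℂ
  | false, false, false, false => a
  | true, true, true, true => a
  | true, false, true, false => b
  | false, true, false, true => b
  | true, false, false, true => c
  | false, true, true, false => c
  | _, _, _, _ => 0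

def Vertex.weight20 (ω : Fin 7 → ℂ) (u : Vertex) : ℂ :=
  TwentyVertex.weight20 ω (u.inc .hor) (u.inc .diag) (u.inc .vert)
    (u.out .hor) (u.out .diag) (u.out .vert)

def Vertex.weight6 (a b c : ℂ) (u : Vertex) : ℂ :=
  TwentyVertex.weight6 a b c (u.inc .hor) (u.inc .vert) (u.out .hor) (u.out .vert)

section Weights

variable (η lam μ : ℂ)

/-- The weights `ω₀, …, ω₆` of the 20V model. -/
noncomputable def omega : Fin 7 → ℂ :=
  open Complex in
  ![sin (lam + η) * sin ((lam + 3 * η + μ) / 2) * sin ((lam + 3 * η - μ) / 2),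
    sin (lam - η) * sin ((lam - η + μ) / 2) * sin ((lam + 3 * η - μ) / 2),
    sin (2 * η) * sin (lam - η) * sin ((lam + 3 * η - μ) / 2),
    sin (2 * η) ^ 3 + sin (lam + η) * sin ((lam - η + μ) / 2) * sin ((lam - η - μ) / 2),
    sin (2 * η) * sin ((lam + 3 * η + μ) / 2) * sin ((lam + 3 * η - μ) / 2),
    sin (2 * η) * sin (lam - η) * sin ((lam + 3 * η + μ) / 2),
    sin (lam - η) * sin ((lam + 3 * η + μ) / 2) * sin ((lam - η - μ) / 2)]

/-- The weight `a = sin (λ + η)` of the 6V model. -/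
noncomputable def a6 : ℂ := Complex.sin (lam + η)

/-- The weight `b = sin (λ - η)` of the 6V model. -/
noncomputable def b6 : ℂ := Complex.sin (lam - η)

/-- The weight `c = sin (2 η)` of the 6V model. -/
noncomputable def c6 : ℂ := Complex.sin (2 * η)

/-- `q = exp (i η)`. -/
noncomputable def qPar : ℂ := Complex.exp (Complex.I * η)

/-- The horizontal spectral parameter `z = exp (i (η + λ))`. -/
noncomputable def zPar : ℂ := Complex.exp (Complex.I * (η + lam))

/-- The vertical spectral parameter `w = exp (- i (η + λ))`. -/
noncomputable def wPar : ℂ := Complex.exp (-(Complex.I * (η + lam)))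

/-- The diagonal spectral parameter `t = exp (i μ)`. -/
noncomputable def tPar : ℂ := Complex.exp (Complex.I * μ)

/-- The cube root `t ^ (1 / 3) = exp (i μ / 3)`. -/
noncomputable def tCbrt : ℂ := Complex.exp (Complex.I * μ / 3)

/-- The normalization `ν = 1 / (2 i t ^ (1 / 3))`. -/
noncomputable def nuPar : ℂ := 1 / (2 * Complex.I * tCbrt μ)

/-- `a₂ = ν (q z - q⁻¹ t)`. -/
noncomputable def a2 : ℂ := nuPar μ * (qPar η * zPar η lam - (qPar η)⁻¹ * tPar μ)

/-- `a₃ = ν (q t - q⁻¹ w)`. -/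
noncomputable def a3 : ℂ := nuPar μ * (qPar η * tPar μ - (qPar η)⁻¹ * wPar η lam)

/-- The common denominator of `tau` and `gFun`. -/
noncomputable def den (σ : ℂ) : ℂ :=
  open Complex in
  σ * sin (lam - η) * sin ((lam - η - μ) / 2) - sin (lam + η) * sin ((lam - 5 * η - μ) / 2)

/-- `τ` as a function of `σ`. -/
noncomputable def tau (σ : ℂ) : ℂ :=
  open Complex in
  σ * ((σ * sin (lam - η) * sin ((lam + 3 * η - μ) / 2)
      - sin (lam + η) * sin ((lam - η - μ) / 2)) / den η lam μ σ)
    * (sin ((lam + 3 * η + μ) / 2) / sin ((lam - η + μ) / 2))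

/-- The function `g (σ)`. -/
noncomputable def gFun (σ : ℂ) : ℂ :=
  open Complex in
  σ * sin (2 * η) * sin ((lam + 3 * η + μ) / 2) / den η lam μ σ

end Weights

section PartitionFunctions

variable (n : ℕ) (η lam μ : ℂ)

open scoped Classical in
/-- The partition function of the 20V configurations with DWBC2 whose uppermost path hits the line
of the last column at the node of height `y` by a step `s`. -/
noncomputable def Z20At (s : Step) (y : Fin n) : ℂ :=
  ∑ c : EdgeConfig n with c.IsTwentyV ∧ c.HitsRight y s,
    ∏ x, ∏ y', (c.vertex x y').weight20 (omega η lam μ)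

/-- The refined partition function of the 20V model with DWBC2, restricted to the configurations
whose uppermost path hits the line of the last column by a step `s`. The index `y` is `L - 1`,
where `L = 1, …, n` is the height of the hitting point. -/
noncomputable def Z20 (s : Step) (τ : ℂ) : ℂ :=
  ∑ y : Fin n, Z20At n η lam μ s y * τ ^ (y : ℕ)

open scoped Classical in
/-- The partition function of the 6V configurations with DWBC whose uppermost path hits the line
of the last column at the node of height `y`. -/
noncomputable def Z6At (y : Fin n) : ℂ :=
  ∑ c : EdgeConfig n with c.IsSixV ∧ ∃ s, c.HitsRight y s,
    ∏ x, ∏ y', (c.vertex x y').weight6 (a6 η lam) (b6 η lam) (c6 η)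

/-- The refined partition function of the 6V model with DWBC. The index `y` is `L - 1`, where
`L = 1, …, n` is the height of the hitting point. -/
noncomputable def Z6 (σ : ℂ) : ℂ :=
  ∑ y : Fin n, Z6At n η lam y * σ ^ (y : ℕ)

end PartitionFunctions

end TwentyVertex

/-!
The square with its triangular lattice is an arrangement of `n` horizontal, `n` vertical and
`2 n - 1` diagonal lines, three of them through every node. The 20V weights factor: pushing the
diagonal line slightly off a node resolves the node into three crossings with 6V weights, and by the
Yang-Baxter equation the side to which it is pushed does not matter. So every diagonal can be moved
across all the horizontal-vertical crossings. After this the boundary values freeze its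
crossings with the other lines: each of them has weight `a₂` or `a₃`, which gives `(a₂ a₃) ^ n²`,
and what is left is the 6V model.

For the refined sums, the last column carries the weight `bL = σ b` instead of `b`. The Yang-Baxter
equation fails there in general, but because the East and Southeast edges of these nodes are
unoccupied, only two of its instances are needed. They determine modified weights
`b₃L` and `c₃L` for the crossings of the last vertical line with the diagonals. On the 20V side, the
modification multiplies the weight of a node of the last column by `τ` when its North edge is
occupied and else by `g` when its Northwest edge is. The only path on the last vertical line is the
uppermost one, from its hitting point downwards, so the product of these factors is `τ ^ (L - 1)`,
times `g` when the last step is diagonal.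
-/

namespace TwentyVertex

open Function

section ListProd

variable {M α : Type*} [Monoid M]

theorem commute_prod_map {x : M} {f : α → M} {L : List α} (h : ∀ i ∈ L, Commute x (f i)) :
    Commute x (L.map f).prod :=
  .list_prod_right _ _ <| List.forall_mem_map.2 h

theorem prod_map_mul_of_commute {f g : α → M} {L : List α}
    (h : L.Pairwise fun i j => Commute (f j) (g i)) :
    (L.map fun i => f i * g i).prod = (L.map f).prod * (L.map g).prod := by
  induction h with
  | nil => simp
  | @cons i L hi _ ih =>
    have comm : Commute (g i) (L.map f).prod := commute_prod_map fun j hj => (hi j hj).symm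
    simp only [List.map_cons, List.prod_cons, ih, mul_assoc]
    rw [← mul_assoc (g i), comm.eq, mul_assoc]

theorem prod_range_succ_map_mul (f g : ℕ → M) (m : ℕ) :
    ((List.range (m + 1)).map fun i => f i * g i).prod
      = f 0 * ((List.range m).map fun i => g i * f (i + 1)).prod * g m := by
  induction m with
  | zero => simp [List.range_succ]
  | succ m ih =>
    rw [List.prod_range_succ, ih, List.prod_range_succ _ m]
    simp only [mul_assoc]

/-- The antidiagonal row of the `p` nodes `(o, o + p - 1), …, (o + p - 1, o)`. -/
def row (o p : ℕ) : List (ℕ × ℕ) := (List.range p).map fun i => (o + i, o + p - 1 - i)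

/-- The nodes below the antidiagonal of a square of size `m`, listed by the rows that start on its
left side. -/
def lowerNodes (m : ℕ) : List (ℕ × ℕ) := (List.range m).flatMap (row 0)

/-- The nodes of a square with lower left corner `(o, o)` and size `p` that are not below its
antidiagonal, listed by rows. -/
def upperNodes : ℕ → ℕ → List (ℕ × ℕ)
  | _, 0 => []
  | o, p + 1 => row o (p + 1) ++ upperNodes (o + 1) p

theorem lowerNodes_succ (m : ℕ) : lowerNodes (m + 1) = lowerNodes m ++ row 0 m := by
  simp [lowerNodes, List.range_succ]

theorem mem_row {o p : ℕ} {u : ℕ × ℕ} :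
    u ∈ row o p ↔ o ≤ u.1 ∧ o ≤ u.2 ∧ u.1 + u.2 + 1 = o + o + p := by
  obtain ⟨x, y⟩ := u
  simp only [row, List.mem_map, List.mem_range, Prod.mk.injEq]
  constructor
  · rintro ⟨i, hi, rfl, rfl⟩
    omega
  · intro h
    exact ⟨x - o, by omega, by omega, by omega⟩

theorem mem_lowerNodes {m : ℕ} {u : ℕ × ℕ} : u ∈ lowerNodes m ↔ u.1 + u.2 + 1 < m := by
  simp only [lowerNodes, List.mem_flatMap, List.mem_range, mem_row]
  constructor
  · rintro ⟨p, hp, h⟩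
    omega
  · intro h
    exact ⟨u.1 + u.2 + 1, h, by omega⟩

theorem mem_upperNodes {o p : ℕ} {u : ℕ × ℕ} : u ∈ upperNodes o p ↔
    u.1 < o + p ∧ u.2 < o + p ∧ o + o + p ≤ u.1 + u.2 + 1 := by
  induction p generalizing o with
  | zero => simp only [upperNodes, List.not_mem_nil, false_iff]; omega
  | succ p ih => rw [upperNodes, List.mem_append, mem_row, ih]; omega

theorem pairwise_row (o p : ℕ) : (row o p).Pairwise fun u u' => u.1 < u'.1 ∧ u'.2 < u.2 := by
  refine List.pairwise_map.2 (List.pairwise_lt_range.imp_of_mem fun hi hj hij => ?_)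
  rw [List.mem_range] at hi hj
  constructor <;> omega

theorem row_succ_eq_append (o p : ℕ) :
    row o (p + 1) = (row o (p + 1)).dropLast ++ [(o + p, o)] := by
  have h : row o (p + 1) ≠ [] := by simp [row]
  conv_lhs => rw [← List.dropLast_append_getLast h]
  simp [row, List.range_succ]

theorem prod_map_row_succ_mul_congr {F G : ℕ × ℕ → M} {o p : ℕ} {Z : M}
    (h : ∀ u ∈ row o (p + 1), u.1 < o + p → F u = G u)
    (hlast : F (o + p, o) * Z = G (o + p, o) * Z) :
    ((row o (p + 1)).map F).prod * Z = ((row o (p + 1)).map G).prod * Z := by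
  have hlt : ∀ u ∈ (row o (p + 1)).dropLast, u.1 < o + p := by
    have := pairwise_row o (p + 1)
    rw [row_succ_eq_append, List.pairwise_append] at this
    exact fun u hu => (this.2.2 u hu _ (List.mem_singleton_self _)).1
  rw [row_succ_eq_append]
  simp only [List.map_append, List.prod_append, List.map_singleton, List.prod_singleton, mul_assoc,
    hlast]
  rw [List.map_congr_left fun u hu => h u (List.dropLast_subset _ hu) (hlt u hu)]

/-- The product of the crossings of a diagonal that passes below a row with the horizontal lines,
`X y`, and the vertical lines, `Y x`. -/
def below (X Y : ℕ → M) (o p : ℕ) : M := ((row o p).map fun u => X u.2 * Y u.1).prod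

/-- The product of the crossings of a diagonal that passes above a row. -/
def above (X Y : ℕ → M) (o p : ℕ) : M := ((row o p).map fun u => Y u.1 * X u.2).prod

@[simp]
theorem below_zero (X Y : ℕ → M) (o : ℕ) : below X Y o 0 = 1 := rfl

theorem below_succ (X Y : ℕ → M) (o p : ℕ) :
    below X Y o (p + 1) = X (o + p) * above X Y o p * Y (o + p) := by
  simp only [below, above, row, List.map_map]
  refine (prod_range_succ_map_mul
    (fun i => X (o + (p + 1) - 1 - i)) (fun i => Y (o + i)) p).trans ?_
  congr 4
  funext i
  simp only [comp_apply]
  congr 2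
  omega

theorem above_succ (X Y : ℕ → M) (o p : ℕ) :
    above X Y o (p + 1) = Y o * below X Y (o + 1) p * X o := by
  simp only [below, above, row, List.map_map]
  refine (prod_range_succ_map_mul
    (fun i => Y (o + i)) (fun i => X (o + (p + 1) - 1 - i)) p).trans ?_
  rw [show o + (p + 1) - 1 - p = o by omega]
  congr 4
  funext i
  simp only [comp_apply]
  congr 2 <;> omega

section Row

variable {X Y : ℕ → M} {R : ℕ × ℕ → M} {o p : ℕ}
  (hX : ∀ (y : ℕ) (u : ℕ × ℕ), u.2 ≠ y → Commute (X y) (R u))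
  (hY : ∀ (x : ℕ) (u : ℕ × ℕ), u.1 ≠ x → Commute (Y x) (R u))
include hX hY

theorem below_mul_prod_row : below X Y o p * ((row o p).map R).prod
    = ((row o p).map fun u => X u.2 * Y u.1 * R u).prod :=
  (prod_map_mul_of_commute <| (pairwise_row o p).imp fun ⟨h₁, h₂⟩ =>
    .mul_left (hX _ _ h₂.ne') (hY _ _ h₁.ne)).symm

theorem prod_row_mul_above : ((row o p).map R).prod * above X Y o p
    = ((row o p).map fun u => R u * (Y u.1 * X u.2)).prod :=
  (prod_map_mul_of_commute <| (pairwise_row o p).imp fun ⟨h₁, h₂⟩ =>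
    .mul_right (hY _ _ h₁.ne').symm (hX _ _ h₂.ne).symm).symm

end Row

end ListProd

section Operators

variable {ι : Type*}

/-- The projection to the functions supported on the states where the line `i` has the
occupation `b`. -/
noncomputable def pin (i : ι) (b : Bool) : Module.End ℂ ((ι → Bool) → ℂ) :=
  LinearMap.mulLeft ℂ fun s => if s i = b then 1 else 0

theorem pin_apply {i : ι} {b : Bool} {φ : (ι → Bool) → ℂ} {s : ι → Bool} :
    pin i b φ s = if s i = b then φ s else 0 := by
  simp [pin]

variable [DecidableEq ι]

/-- The transfer operator of the crossing of the lines `i` and `j`, acting on the functions of the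
occupation of all lines. It replaces the incoming states of the two lines by outgoing ones,
summed with the weights `M`. -/
noncomputable def crossOp (i j : ι) (M : Bool → Bool → Bool → Bool → ℂ) :
    Module.End ℂ ((ι → Bool) → ℂ) :=
  ∑ p, ∑ q, LinearMap.mulLeft ℂ (fun s => M (s i) (s j) p q)
    * LinearMap.funLeft ℂ ℂ fun s => update (update s i p) j q

/-- The transfer operator of a node where the lines `i`, `j` and `k` meet. -/
noncomputable def nodeOp (i j k : ι) (M : Bool → Bool → Bool → Bool → Bool → Bool → ℂ) :
    Module.End ℂ ((ι → Bool) → ℂ) :=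
  ∑ p, ∑ q, ∑ r, LinearMap.mulLeft ℂ (fun s => M (s i) (s j) (s k) p q r)
    * LinearMap.funLeft ℂ ℂ fun s => update (update (update s i p) j q) k r

variable {i j k l : ι} {M : Bool → Bool → Bool → Bool → ℂ} {φ : (ι → Bool) → ℂ} {s : ι → Bool}

theorem crossOp_apply : crossOp i j M φ s
    = ∑ p, ∑ q, M (s i) (s j) p q * φ (update (update s i p) j q) := by
  simp [crossOp, LinearMap.funLeft_apply]

theorem nodeOp_apply {M : Bool → Bool → Bool → Bool → Bool → Bool → ℂ} : nodeOp i j k M φ s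
    = ∑ p, ∑ q, ∑ r, M (s i) (s j) (s k) p q r
        * φ (update (update (update s i p) j q) k r) := by
  simp [nodeOp, LinearMap.funLeft_apply]

theorem crossOp_commute (hik : i ≠ k) (hil : i ≠ l) (hjk : j ≠ k) (hjl : j ≠ l)
    (M M' : Bool → Bool → Bool → Bool → ℂ) : Commute (crossOp i j M) (crossOp k l M') := by
  refine LinearMap.ext fun φ => funext fun s => ?_
  have update_swap : ∀ p q p' q' : Bool, update (update (update (update s i p) j q) k p') l q'
      = update (update (update (update s k p') l q') i p) j q := by
    intro p q p' q'
    rw [update_comm hjk, update_comm hik, update_comm hjl, update_comm hil]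
  simp only [Module.End.mul_apply, crossOp_apply, Fintype.sum_bool, update_swap]
  simp only [update_of_ne hik, update_of_ne hil, update_of_ne hjk, update_of_ne hjl,
    update_of_ne hik.symm, update_of_ne hil.symm, update_of_ne hjk.symm, update_of_ne hjl.symm]
  ring

theorem commute_pin_crossOp (hi : l ≠ i) (hj : l ≠ j) (b : Bool)
    (M : Bool → Bool → Bool → Bool → ℂ) : Commute (pin l b) (crossOp i j M) := by
  refine LinearMap.ext fun φ => funext fun s => ?_
  simp [crossOp_apply, pin_apply, update_of_ne hi, update_of_ne hj, Finset.sum_ite_irrel]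

theorem commute_pin_nodeOp (hi : l ≠ i) (hj : l ≠ j) (hk : l ≠ k) (b : Bool)
    (M : Bool → Bool → Bool → Bool → Bool → Bool → ℂ) : Commute (pin l b) (nodeOp i j k M) := by
  refine LinearMap.ext fun φ => funext fun s => ?_
  simp [nodeOp_apply, pin_apply, update_of_ne hi, update_of_ne hj, update_of_ne hk,
    Finset.sum_ite_irrel]

section Frozen

variable {a : ℂ} {b b' : Bool}

theorem pin_mul_pin_mul_crossOp (hM : ∀ p q, M b b' p q = if p = b ∧ q = b' then a else 0) :
    pin i b * pin j b' * crossOp i j M = a • (pin i b * pin j b') := by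
  refine LinearMap.ext fun φ => funext fun s => ?_
  rcases eq_or_ne (s i) b with rfl | hi
  · rcases eq_or_ne (s j) b' with rfl | hj
    · simp [pin_apply, crossOp_apply, hM, ite_and]
    · simp [pin_apply, hj]
  · simp [pin_apply, hi]

theorem crossOp_mul_pin_mul_pin (hij : i ≠ j)
    (hM : ∀ p q, M p q b b' = if p = b ∧ q = b' then a else 0) :
    crossOp i j M * (pin i b * pin j b') = a • (pin i b * pin j b') := by
  refine LinearMap.ext fun φ => funext fun s => ?_
  rcases eq_or_ne (s i) b with rfl | hi
  · rcases eq_or_ne (s j) b' with rfl | hj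
    · simp [pin_apply, crossOp_apply, hij, hM]
    · simp [pin_apply, crossOp_apply, hij, hM, hj]
  · simp [pin_apply, crossOp_apply, hij, hM, hi]

theorem pin_mul_crossOp_mul_pin (hM : ∀ p q, M b p q b' = if p = b' ∧ q = b then a else 0) :
    pin i b * crossOp i j M * pin j b' = a • (pin i b * pin j b') := by
  refine LinearMap.ext fun φ => funext fun s => ?_
  rcases eq_or_ne (s i) b with rfl | hi
  · rcases eq_or_ne (s j) b' with rfl | hj
    · simp [pin_apply, crossOp_apply, hM]
    · simp [pin_apply, crossOp_apply, hM, hj]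
  · simp [pin_apply, hi]

theorem pin_mul_crossOp_mul_pin' (hij : i ≠ j)
    (hM : ∀ p q, M p b b' q = if p = b' ∧ q = b then a else 0) :
    pin j b * crossOp i j M * pin i b' = a • (pin j b * pin i b') := by
  refine LinearMap.ext fun φ => funext fun s => ?_
  rcases eq_or_ne (s j) b with hj | hj
  · have hs : update s j b = s := by rw [← hj, update_eq_self]
    rcases eq_or_ne (s i) b' with rfl | hi
    · cases b <;> simp [pin_apply, crossOp_apply, hij, hM, hj, hs]
    · simp [pin_apply, crossOp_apply, hij, hM, hj, hi]
  · simp [pin_apply, hj]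

end Frozen

section Triangle

variable (hij : i ≠ j) (hik : i ≠ k) (hjk : j ≠ k) (A B C : Bool → Bool → Bool → Bool → ℂ)
include hij hik hjk

theorem crossOp_mul_crossOp_mul_crossOp_below :
    crossOp i k A * crossOp j k B * crossOp i j C = nodeOp i j k fun W S I E N O =>
      ∑ p, ∑ r, A W I p r * ∑ q, B S r q O * C p q E N := by
  refine LinearMap.ext fun φ => funext fun s => ?_
  have update_update (p r q O E N : Bool) :
      update (update (update (update (update (update s i p) k r) j q) k O) i E) j N
        = update (update (update s i E) j N) k O := by
    funext l
    simp only [update_apply]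
    split_ifs <;> simp_all
  simp only [Module.End.mul_apply, crossOp_apply, nodeOp_apply, update_update, update_self,
    update_of_ne hij, update_of_ne hik, update_of_ne hjk, update_of_ne hij.symm, Fintype.sum_bool]
  ring

theorem crossOp_mul_crossOp_mul_crossOp_above :
    crossOp i j C * (crossOp j k B * crossOp i k A) = nodeOp i j k fun W S I E N O =>
      ∑ p, ∑ q, C W S p q * ∑ r, B q I N r * A p r E O := by
  refine LinearMap.ext fun φ => funext fun s => ?_
  have update_update (p q r N E O : Bool) :
      update (update (update (update (update (update s i p) j q) j N) k r) i E) k O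
        = update (update (update s i E) j N) k O := by
    funext l
    simp only [update_apply]
    split_ifs <;> simp_all
  simp only [Module.End.mul_apply, crossOp_apply, nodeOp_apply, update_update, update_self,
    update_of_ne hij, update_of_ne hik, update_of_ne hik.symm, update_of_ne hjk.symm,
    Fintype.sum_bool]
  ring

end Triangle

theorem nodeOp_mul_congr (hij : i ≠ j) (hik : i ≠ k)
    {M M' : Bool → Bool → Bool → Bool → Bool → Bool → ℂ} {b b' : Bool}
    (h : ∀ p q r q', M p q r b q' b' = M' p q r b q' b') {Z : Module.End ℂ ((ι → Bool) → ℂ)}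
    (hi : pin i b * Z = Z) (hk : pin k b' * Z = Z) : nodeOp i j k M * Z = nodeOp i j k M' * Z := by
  rw [← hi, ← hk]
  refine LinearMap.ext fun φ => funext fun s => ?_
  simp [nodeOp_apply, pin_apply, hij, hik, h]

end Operators

/-- The lines of the triangular lattice. The diagonal `d k` carries the edges `d i j` with
`i + j = k`, hence the nodes `(x, y)` with `x + y + 1 = k`. -/
inductive Line
  | h (y : ℕ)
  | v (x : ℕ)
  | d (k : ℕ)
  deriving DecidableEq

/-- An occupation of the lines, as seen along a staircase that crosses each of them once. -/
abbrev State := Line → Bool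

/-- The weights of the crossing of a horizontal and a vertical line; the arguments tell whether
the edges West, South | East, North are occupied. -/
def horVert (a b c : ℂ) (W S E N : Bool) : ℂ := weight6 a b c W N E S

/-- The weights of the crossing of a vertical and a diagonal line; the arguments tell whether
the edges South, Northwest | North, Southeast are occupied. -/
def vertDiag (a b c : ℂ) (S I N O : Bool) : ℂ := weight6 a b c I N O S

/-- The weights of a node; the arguments tell whether the edges
West, South, Northwest | East, North, Southeast are occupied. -/
def node20 (ω : Fin 7 → ℂ) (W S I E N O : Bool) : ℂ := weight20 ω W I N E O S

/-- The weights of the 20V model obtained by resolving a node into three crossings. -/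
def triWeights (a b c a₂ b₂ a₃ b₃ : ℂ) : Fin 7 → ℂ :=
  ![a * a₃ * a₂, b * b₃ * a₂, c * b * a₂, c ^ 3 + a * b₃ * b₂, c * a₃ * a₂, c * b * a₃,
    b * a₃ * b₂]

section YangBaxter

variable {a b c a₂ b₂ a₃ b₃ : ℂ}

theorem sum_below_eq_node20 (h₁ : b * a₂ = a * b₂ + c * b₃) (h₂ : a₂ * a₃ = b₂ * b₃ + c * a)
    (h₃ : b * a₃ = a * b₃ + c * b₂) (W S I E N O : Bool) :
    ∑ p, ∑ r, weight6 a₂ b₂ c W I p r * ∑ q, vertDiag a₃ b₃ c S r q O * horVert a b c p q E N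
      = node20 (triWeights a b c a₂ b₂ a₃ b₃) W S I E N O := by
  cases W <;> cases S <;> cases I <;> cases E <;> cases N <;> cases O <;>
    simp only [Fintype.sum_bool, weight6, horVert, vertDiag, node20, weight20, triWeights,
      Matrix.cons_val] <;>
    first
    | ring1
    | linear_combination c * h₁
    | linear_combination -c * h₁
    | linear_combination c * h₂
    | linear_combination -c * h₂
    | linear_combination c * h₃
    | linear_combination -c * h₃

theorem sum_above_eq_node20 (h₁ : b * a₂ = a * b₂ + c * b₃) (h₂ : a₂ * a₃ = b₂ * b₃ + c * a)
    (h₃ : b * a₃ = a * b₃ + c * b₂) (W S I E N O : Bool) :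
    ∑ p, ∑ q, horVert a b c W S p q * ∑ r, vertDiag a₃ b₃ c q I N r * weight6 a₂ b₂ c p r E O
      = node20 (triWeights a b c a₂ b₂ a₃ b₃) W S I E N O := by
  cases W <;> cases S <;> cases I <;> cases E <;> cases N <;> cases O <;>
    simp only [Fintype.sum_bool, weight6, horVert, vertDiag, node20, weight20, triWeights,
      Matrix.cons_val] <;>
    first
    | ring1
    | linear_combination c * h₁
    | linear_combination -c * h₁
    | linear_combination c * h₂
    | linear_combination -c * h₂
    | linear_combination c * h₃
    | linear_combination -c * h₃

theorem sum_below_eq_sum_above_of_exit {c' : ℂ} (h₁ : c' * b * a₂ = b₂ * a * c' + c * c * b₃)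
    (h₂ : c * a₃ * a₂ = b₂ * c * b₃ + c * a * c') (W S I N : Bool) :
    ∑ p, ∑ r, weight6 a₂ b₂ c W I p r
        * ∑ q, vertDiag a₃ b₃ c' S r q false * horVert a b c p q false N
      = ∑ p, ∑ q, horVert a b c W S p q
        * ∑ r, vertDiag a₃ b₃ c' q I N r * weight6 a₂ b₂ c p r false false := by
  cases W <;> cases S <;> cases I <;> cases N <;>
    simp only [Fintype.sum_bool, weight6, horVert, vertDiag] <;>
    first
    | ring1
    | linear_combination h₁
    | linear_combination -h₁
    | linear_combination h₂
    | linear_combination -h₂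

end YangBaxter

/-- The factor of a node of the column `x`: in the last column, `τ` if the North edge is occupied
and else `g` if the Northwest edge is. -/
def exitFactor (τ g : ℂ) (n x : ℕ) (I N : Bool) : ℂ :=
  if x + 1 = n then (if N then τ else if I then g else 1) else 1

/-- The weights of the model: those of the crossings of a horizontal and a vertical line
(`a`, `b`, `c`), of a horizontal and a diagonal line (`a₂`, `b₂`, `c`) and of a vertical and a
diagonal line (`a₃`, `b₃`, `c`), their modifications in the last column (`bL`, `b₃L`, `c₃L`), and
the corresponding factors `τ`, `g` of the node weights. -/
structure Weights where
  (a b c a₂ b₂ a₃ b₃ bL b₃L c₃L τ g : ℂ)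

/-- The Yang-Baxter relations in the bulk (`hor`, `prod`, `vert`), those in the last column, where
the horizontal and the diagonal line leave the node unoccupied (`horL`, `prodL`), and the relations
that resolve the node weights of the last column into the modified crossing weights. -/
structure Weights.Compatible (w : Weights) : Prop where
  hor : w.b * w.a₂ = w.a * w.b₂ + w.c * w.b₃
  prod : w.a₂ * w.a₃ = w.b₂ * w.b₃ + w.c * w.a
  vert : w.b * w.a₃ = w.a * w.b₃ + w.c * w.b₂
  horL : w.c₃L * w.bL * w.a₂ = w.b₂ * w.a * w.c₃L + w.c * w.c * w.b₃L
  prodL : w.c * w.a₃ * w.a₂ = w.b₂ * w.c * w.b₃L + w.c * w.a * w.c₃L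
  tau_eq : w.τ * (w.b * w.b₃) = w.bL * w.b₃L
  g_eq : w.g * (w.c * w.b) = w.c₃L * w.bL

namespace Weights

variable (w : Weights) (n : ℕ)

/-- The node weights of the 20V model, without the factors of the last column. -/
def nodeWeights : Fin 7 → ℂ := triWeights w.a w.b w.c w.a₂ w.b₂ w.a₃ w.b₃

/-- The weights of the crossing of the vertical line `x` and a horizontal line. -/
def hvWeight (x : ℕ) : Bool → Bool → Bool → Bool → ℂ :=
  horVert w.a (if x + 1 = n then w.bL else w.b) w.c

/-- The weights of the crossing of the vertical line `x` and a diagonal line. -/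
def vdWeight (x : ℕ) : Bool → Bool → Bool → Bool → ℂ :=
  vertDiag w.a₃ (if x + 1 = n then w.b₃L else w.b₃) (if x + 1 = n then w.c₃L else w.c)

/-- The node weights in the column `x`. -/
def nodeWeight (x : ℕ) (W S I E N O : Bool) : ℂ :=
  exitFactor w.τ w.g n x I N * node20 w.nodeWeights W S I E N O

/-- The transfer operator of the crossing of the horizontal line `u.2` and the vertical line
`u.1`. -/
noncomputable def hv (u : ℕ × ℕ) : Module.End ℂ (State → ℂ) :=
  crossOp (.h u.2) (.v u.1) (w.hvWeight n u.1)

/-- The transfer operator of the crossing of the diagonal `k` and the horizontal line `y`. -/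
noncomputable def hd (k y : ℕ) : Module.End ℂ (State → ℂ) :=
  crossOp (.h y) (.d k) (weight6 w.a₂ w.b₂ w.c)

/-- The transfer operator of the crossing of the diagonal `k` and the vertical line `x`. -/
noncomputable def vd (k x : ℕ) : Module.End ℂ (State → ℂ) :=
  crossOp (.v x) (.d k) (w.vdWeight n x)

/-- The transfer operator of the node `u` of the triangular lattice. -/
noncomputable def node (u : ℕ × ℕ) : Module.End ℂ (State → ℂ) :=
  nodeOp (.h u.2) (.v u.1) (.d (u.1 + u.2 + 1)) (w.nodeWeight n u.1)

variable {w n}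

theorem commute_hd_hv {k y : ℕ} {u : ℕ × ℕ} (h : u.2 ≠ y) : Commute (w.hd k y) (w.hv n u) :=
  crossOp_commute (by simpa using h.symm) (by simp) (by simp) (by simp) _ _

theorem commute_vd_hv {k x : ℕ} {u : ℕ × ℕ} (h : u.1 ≠ x) : Commute (w.vd n k x) (w.hv n u) :=
  crossOp_commute (by simp) (by simpa using h.symm) (by simp) (by simp) _ _

theorem below_mul_row (k o p : ℕ) :
    below (w.hd k) (w.vd n k) o p * ((row o p).map (w.hv n)).prod
      = ((row o p).map fun u => w.hd k u.2 * w.vd n k u.1 * w.hv n u).prod :=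
  below_mul_prod_row (fun _ _ => commute_hd_hv) (fun _ _ => commute_vd_hv)

theorem row_mul_above (k o p : ℕ) :
    ((row o p).map (w.hv n)).prod * above (w.hd k) (w.vd n k) o p
      = ((row o p).map fun u => w.hv n u * (w.vd n k u.1 * w.hd k u.2)).prod :=
  prod_row_mul_above (fun _ _ => commute_hd_hv) (fun _ _ => commute_vd_hv)

namespace Compatible

variable (hw : w.Compatible)
include hw

theorem yangBaxter {u : ℕ × ℕ} {k : ℕ} (hu : u.1 + 1 ≠ n) :
    w.hd k u.2 * w.vd n k u.1 * w.hv n u = w.hv n u * (w.vd n k u.1 * w.hd k u.2) := by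
  simp only [hd, vd, hv, hvWeight, vdWeight, if_neg hu]
  rw [crossOp_mul_crossOp_mul_crossOp_below (by simp) (by simp) (by simp),
    crossOp_mul_crossOp_mul_crossOp_above (by simp) (by simp) (by simp)]
  simp only [sum_below_eq_node20 hw.hor hw.prod hw.vert, sum_above_eq_node20 hw.hor hw.prod hw.vert]

theorem node_eq {u : ℕ × ℕ} (hu : u.1 + 1 ≠ n) :
    w.node n u = w.hd (u.1 + u.2 + 1) u.2 * w.vd n (u.1 + u.2 + 1) u.1 * w.hv n u := by
  simp only [hd, vd, hv, hvWeight, vdWeight, if_neg hu]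
  rw [crossOp_mul_crossOp_mul_crossOp_below (by simp) (by simp) (by simp)]
  simp only [sum_below_eq_node20 hw.hor hw.prod hw.vert]
  unfold node
  congr 1
  funext W S I E N O
  simp [nodeWeight, exitFactor, hu, nodeWeights]

variable {Z : Module.End ℂ (State → ℂ)}

theorem yangBaxter_last {u : ℕ × ℕ} {k : ℕ} (hu : u.1 + 1 = n)
    (hh : pin (.h u.2) false * Z = Z) (hd : pin (.d k) false * Z = Z) :
    w.hd k u.2 * w.vd n k u.1 * w.hv n u * Z = w.hv n u * (w.vd n k u.1 * w.hd k u.2) * Z := by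
  simp only [Weights.hd, vd, hv, hvWeight, vdWeight, if_pos hu]
  rw [crossOp_mul_crossOp_mul_crossOp_below (by simp) (by simp) (by simp),
    crossOp_mul_crossOp_mul_crossOp_above (by simp) (by simp) (by simp)]
  exact nodeOp_mul_congr (by simp) (by simp)
    (fun W S I N => sum_below_eq_sum_above_of_exit hw.horL hw.prodL W S I N) hh hd

theorem node_mul_last {u : ℕ × ℕ} (hu : u.1 + 1 = n)
    (hh : pin (.h u.2) false * Z = Z) (hd : pin (.d (u.1 + u.2 + 1)) false * Z = Z) :
    w.node n u * Z = w.hd (u.1 + u.2 + 1) u.2 * w.vd n (u.1 + u.2 + 1) u.1 * w.hv n u * Z := by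
  rw [yangBaxter_last hw hu hh hd]
  simp only [Weights.hd, vd, hv, hvWeight, vdWeight, if_pos hu, node]
  rw [crossOp_mul_crossOp_mul_crossOp_above (by simp) (by simp) (by simp)]
  refine nodeOp_mul_congr (by simp) (by simp) (fun W S I N => ?_) hh hd
  cases W <;> cases S <;> cases I <;> cases N <;>
    simp only [hu, Fintype.sum_bool, nodeWeight, exitFactor, nodeWeights, weight6, horVert,
      vertDiag, node20, weight20, triWeights, Matrix.cons_val, if_true, if_false,
      Bool.false_eq_true] <;>
    first
    | ring1
    | linear_combination w.a₂ * hw.tau_eq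
    | linear_combination w.a₂ * hw.g_eq

theorem below_mul_row_eq {o p : ℕ} (h : o + p < n) (k : ℕ) :
    below (w.hd k) (w.vd n k) o p * ((row o p).map (w.hv n)).prod
      = ((row o p).map (w.hv n)).prod * above (w.hd k) (w.vd n k) o p := by
  rw [below_mul_row, row_mul_above]
  congr 1
  exact List.map_congr_left fun u hu => hw.yangBaxter <| by rw [mem_row] at hu; omega

theorem row_node_eq {p : ℕ} (h : p < n) :
    ((row 0 p).map (w.node n)).prod
      = below (w.hd p) (w.vd n p) 0 p * ((row 0 p).map (w.hv n)).prod := by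
  rw [below_mul_row]
  congr 1
  refine List.map_congr_left fun u hu => ?_
  rw [mem_row] at hu
  rw [hw.node_eq (by omega), show u.1 + u.2 + 1 = p by omega]

variable {o p : ℕ} (h : o + (p + 1) = n)
include h

theorem below_mul_row_mul_eq {k : ℕ} (hh : pin (.h o) false * Z = Z)
    (hd : pin (.d k) false * Z = Z) :
    below (w.hd k) (w.vd n k) o (p + 1) * ((row o (p + 1)).map (w.hv n)).prod * Z
      = ((row o (p + 1)).map (w.hv n)).prod * above (w.hd k) (w.vd n k) o (p + 1) * Z := by
  rw [below_mul_row, row_mul_above]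
  exact prod_map_row_succ_mul_congr (fun u _ hu => hw.yangBaxter (by omega))
    (hw.yangBaxter_last (by dsimp only; omega) hh hd)

theorem row_node_mul_eq (hh : pin (.h o) false * Z = Z)
    (hd : pin (.d (o + n)) false * Z = Z) :
    ((row o (p + 1)).map (w.node n)).prod * Z
      = below (w.hd (o + n)) (w.vd n (o + n)) o (p + 1)
          * ((row o (p + 1)).map (w.hv n)).prod * Z := by
  rw [below_mul_row]
  refine prod_map_row_succ_mul_congr (fun u hu hlt => ?_) ?_
  · rw [mem_row] at hu
    rw [hw.node_eq (by omega), show u.1 + u.2 + 1 = o + n by omega]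
  · rw [show o + n = (o + p, o).1 + (o + p, o).2 + 1 by dsimp only; omega] at hd ⊢
    exact hw.node_mul_last (by dsimp only; omega) hh hd

end Compatible

theorem commute_pin_hv {l : Line} {b : Bool} {U : List (ℕ × ℕ)}
    (h : ∀ u ∈ U, l ≠ .h u.2 ∧ l ≠ .v u.1) : Commute (pin l b) (U.map (w.hv n)).prod :=
  commute_prod_map fun u hu => commute_pin_crossOp (h u hu).1 (h u hu).2 _ _

theorem commute_pin_node {l : Line} {b : Bool} {U : List (ℕ × ℕ)}
    (h : ∀ u ∈ U, l ≠ .h u.2 ∧ l ≠ .v u.1 ∧ l ≠ .d (u.1 + u.2 + 1)) :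
    Commute (pin l b) (U.map (w.node n)).prod :=
  commute_prod_map fun u hu => commute_pin_nodeOp (h u hu).1 (h u hu).2.1 (h u hu).2.2 _ _

theorem commute_pin_below {l : Line} {b : Bool} {k o p : ℕ} (hd : l ≠ .d k)
    (h : ∀ u ∈ row o p, l ≠ .h u.2 ∧ l ≠ .v u.1) :
    Commute (pin l b) (below (w.hd k) (w.vd n k) o p) :=
  commute_prod_map fun u hu =>
    .mul_right (commute_pin_crossOp (h u hu).1 hd _ _) (commute_pin_crossOp (h u hu).2 hd _ _)

section Absorb

variable {A : Type*} [Monoid A] {P L T Z : A}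

theorem mul_mul_eq_of_commute_left (h : Commute P T) (hP : P * Z = Z) : P * (T * Z) = T * Z := by
  rw [← mul_assoc, h.eq, mul_assoc, hP]

theorem mul_mul_eq_of_commute_right (h : Commute P T) (hP : L * P = L) : L * T * P = L * T := by
  rw [mul_assoc, ← h.eq, ← mul_assoc, hP]

end Absorb

section Frozen

variable {k x y : ℕ} {L Z : Module.End ℂ (State → ℂ)}

theorem mul_hd_of_full (hh : L * pin (.h y) true = L) (hd : L * pin (.d k) true = L) :
    L * w.hd k y = w.a₂ • L := by
  have hL : L * (pin (.h y) true * pin (.d k) true) = L := by rw [← mul_assoc, hh, hd]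
  rw [← hL, mul_assoc, Weights.hd, pin_mul_pin_mul_crossOp (a := w.a₂) (by simp [weight6]),
    mul_smul_comm]

theorem mul_vd_mul_of_full (hv : L * pin (.v x) true = L) (hd : pin (.d k) true * Z = Z) :
    L * w.vd n k x * Z = w.a₃ • (L * Z) := by
  have frozen := pin_mul_crossOp_mul_pin (i := Line.v x) (j := .d k) (M := w.vdWeight n x)
    (a := w.a₃) (b := true) (b' := true) (by simp [vdWeight, vertDiag, weight6])
  calc L * w.vd n k x * Z = L * (pin (.v x) true * w.vd n k x * pin (.d k) true) * Z := by
        simp only [← mul_assoc, hv]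
        rw [mul_assoc _ (pin _ _), hd]
    _ = w.a₃ • (L * Z) := by
        rw [vd, frozen, mul_smul_comm, smul_mul_assoc, ← mul_assoc, hv, mul_assoc, hd]

theorem hd_mul_of_empty (hh : pin (.h y) false * Z = Z) (hd : pin (.d k) false * Z = Z) :
    w.hd k y * Z = w.a₂ • Z := by
  have hZ : pin (.h y) false * pin (.d k) false * Z = Z := by rw [mul_assoc, hd, hh]
  rw [← hZ, ← mul_assoc, Weights.hd,
    crossOp_mul_pin_mul_pin (a := w.a₂) (by simp) (by simp [weight6]), smul_mul_assoc]

theorem mul_vd_mul_of_empty (hd : L * pin (.d k) false = L) (hv : pin (.v x) false * Z = Z) :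
    L * w.vd n k x * Z = w.a₃ • (L * Z) := by
  have frozen := pin_mul_crossOp_mul_pin' (i := Line.v x) (j := .d k) (M := w.vdWeight n x)
    (a := w.a₃) (b := false) (b' := false) (by simp) (by simp [vdWeight, vertDiag, weight6])
  calc L * w.vd n k x * Z = L * (pin (.d k) false * w.vd n k x * pin (.v x) false) * Z := by
        simp only [← mul_assoc, hd]
        rw [mul_assoc _ (pin _ _), hv]
    _ = w.a₃ • (L * Z) := by
        rw [vd, frozen, mul_smul_comm, smul_mul_assoc, ← mul_assoc, hd, mul_assoc, hv]

end Frozen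

section Lower

variable {L D : Module.End ℂ (State → ℂ)} (hL : ∀ i, L * pin (.h i) true = L)
  (hL' : ∀ i, L * pin (.v i) true = L)
include hL hL'

theorem lower_mul_below (hw : w.Compatible) {k m : ℕ} (hm : m < n)
    (hLk : L * pin (.d k) true = L) (hD : pin (.d k) true * D = D) :
    L * ((lowerNodes m).map (w.hv n)).prod * below (w.hd k) (w.vd n k) 0 m * D
      = (w.a₂ * w.a₃) ^ m • (L * ((lowerNodes m).map (w.hv n)).prod * D) := by
  induction m generalizing D with
  | zero => simp
  | succ m ih =>
    set lower := ((lowerNodes m).map (w.hv n)).prod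
    set r := ((row 0 m).map (w.hv n)).prod
    have succ_eq : ((lowerNodes (m + 1)).map (w.hv n)).prod = lower * r := by
      rw [lowerNodes_succ, List.map_append, List.prod_append]
    have hd_lower : Commute (w.hd k m) (lower * r) := by
      rw [← succ_eq]
      exact commute_prod_map fun u hu => commute_hd_hv <| by rw [mem_lowerNodes] at hu; omega
    have pin_lower : Commute (pin (.v m) true) (lower * below (w.hd k) (w.vd n k) 0 m * r) :=
      .mul_right
        (.mul_right (commute_pin_hv <| by grind [mem_lowerNodes])
          (commute_pin_below (by simp) <| by grind [mem_row]))
        (commute_pin_hv <| by grind [mem_row])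
    have pin_r : Commute (pin (.d k) true) r := commute_pin_hv (by simp)
    calc L * ((lowerNodes (m + 1)).map (w.hv n)).prod * below (w.hd k) (w.vd n k) 0 (m + 1) * D
      _ = L * w.hd k m * (lower * (r * above (w.hd k) (w.vd n k) 0 m)) * w.vd n k m * D := by
        rw [succ_eq, below_succ, zero_add, mul_assoc L _ (_ * _ * _), ← mul_assoc (lower * r),
          ← mul_assoc (lower * r), ← hd_lower.eq]
        simp only [mul_assoc]
      _ = w.a₂ • (L * (lower * below (w.hd k) (w.vd n k) 0 m * r) * w.vd n k m * D) := by
        rw [mul_hd_of_full (hL m) hLk, ← hw.below_mul_row_eq (by omega)]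
        simp only [smul_mul_assoc, mul_assoc]
        rfl
      _ = (w.a₂ * w.a₃) • (L * lower * below (w.hd k) (w.vd n k) 0 m * (r * D)) := by
        rw [mul_vd_mul_of_full (mul_mul_eq_of_commute_right pin_lower (hL' m)) hD, smul_smul]
        simp only [mul_assoc]
      _ = _ := by
        rw [ih (by omega) (mul_mul_eq_of_commute_left pin_r hD), succ_eq, smul_smul, pow_succ']
        simp only [mul_assoc]

theorem lower_node_mul (hw : w.Compatible) {m : ℕ} (hm : m ≤ n)
    (hLd : ∀ k, 0 < k → k < m → L * pin (.d k) true = L)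
    (hD : ∀ k, 0 < k → k < m → pin (.d k) true * D = D) :
    L * ((lowerNodes m).map (w.node n)).prod * D
      = (w.a₂ * w.a₃) ^ (∑ i ∈ Finset.range m, i)
        • (L * ((lowerNodes m).map (w.hv n)).prod * D) := by
  induction m generalizing D with
  | zero => simp [lowerNodes]
  | succ m ih =>
    set lower := ((lowerNodes m).map (w.hv n)).prod with hlower
    set r := ((row 0 m).map (w.hv n)).prod with hr
    have pin_row {k : ℕ} (hk : k < m) :
        Commute (pin (.d k) true) ((row 0 m).map (w.node n)).prod :=
      commute_pin_node <| by grind [mem_row]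
    have unravel : L * lower * below (w.hd m) (w.vd n m) 0 m * (r * D)
        = (w.a₂ * w.a₃) ^ m • (L * lower * (r * D)) := by
      rcases m.eq_zero_or_pos with rfl | h
      · simp
      · exact lower_mul_below hL hL' hw (by omega) (hLd m h (by omega)) <|
          mul_mul_eq_of_commute_left (commute_pin_hv (by simp)) (hD m h (by omega))
    rw [lowerNodes_succ, List.map_append, List.prod_append, ← mul_assoc, mul_assoc _ _ D,
      ih (by omega) (fun k h₀ h => hLd k h₀ (by omega)) fun k h₀ h =>
        mul_mul_eq_of_commute_left (pin_row h) (hD k h₀ (by omega)),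
      hw.row_node_eq (by omega), mul_assoc _ r D, ← mul_assoc (L * _), unravel, smul_smul,
      ← pow_add, ← Finset.sum_range_succ, List.map_append, List.prod_append]
    simp only [mul_assoc, hlower, hr]

end Lower

section Upper

variable {Q G : Module.End ℂ (State → ℂ)} (hQ : ∀ i < n, pin (.h i) false * Q = Q)
  (hQ' : ∀ i < n, pin (.v i) false * Q = Q)
include hQ hQ'

theorem below_mul_upper (hw : w.Compatible) {k o p : ℕ} (hop : o + p = n)
    (hG : G * pin (.d k) false = G) (hQd : pin (.d k) false * Q = Q) :
    G * below (w.hd k) (w.vd n k) o p * ((upperNodes o p).map (w.hv n)).prod * Q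
      = (w.a₂ * w.a₃) ^ p • (G * ((upperNodes o p).map (w.hv n)).prod * Q) := by
  induction p generalizing o G with
  | zero => simp
  | succ p ih =>
    set r := ((row o (p + 1)).map (w.hv n)).prod with hr
    set upper := ((upperNodes (o + 1) p).map (w.hv n)).prod with hupper
    have succ_eq : ((upperNodes o (p + 1)).map (w.hv n)).prod = r * upper := by
      rw [upperNodes, List.map_append, List.prod_append]
    have pin_h : pin (.h o) false * (upper * Q) = upper * Q :=
      mul_mul_eq_of_commute_left (commute_pin_hv <| by grind [mem_upperNodes]) (hQ o (by omega))
    have pin_v : pin (.v o) false * (below (w.hd k) (w.vd n k) (o + 1) p * (upper * Q))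
        = below (w.hd k) (w.vd n k) (o + 1) p * (upper * Q) :=
      mul_mul_eq_of_commute_left (commute_pin_below (by simp) <| by grind [mem_row]) <|
        mul_mul_eq_of_commute_left (commute_pin_hv <| by grind [mem_upperNodes]) (hQ' o (by omega))
    have pin_d : pin (.d k) false * (upper * Q) = upper * Q :=
      mul_mul_eq_of_commute_left (commute_pin_hv (by simp)) hQd
    have pin_r : G * r * pin (.d k) false = G * r :=
      mul_mul_eq_of_commute_right (commute_pin_hv (by simp)) hG
    calc G * below (w.hd k) (w.vd n k) o (p + 1) * ((upperNodes o (p + 1)).map (w.hv n)).prod * Q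
      _ = G * (below (w.hd k) (w.vd n k) o (p + 1) * r * (upper * Q)) := by
        simp only [succ_eq, mul_assoc]
      _ = G * r * w.vd n k o
          * (below (w.hd k) (w.vd n k) (o + 1) p * (w.hd k o * (upper * Q))) := by
        rw [hw.below_mul_row_mul_eq hop pin_h pin_d, above_succ]
        simp only [mul_assoc, hr]
      _ = w.a₂ • (G * r * w.vd n k o * (below (w.hd k) (w.vd n k) (o + 1) p * (upper * Q))) := by
        rw [hd_mul_of_empty pin_h pin_d, mul_smul_comm, mul_smul_comm]
      _ = (w.a₂ * w.a₃) • (G * r * below (w.hd k) (w.vd n k) (o + 1) p * upper * Q) := by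
        rw [mul_vd_mul_of_empty pin_r pin_v, smul_smul]
        simp only [mul_assoc]
      _ = _ := by
        rw [ih (by omega) pin_r, succ_eq, smul_smul, pow_succ']
        simp only [mul_assoc, hupper]

theorem mul_upper_node (hw : w.Compatible) {o p : ℕ} (hop : o + p = n)
    (hG : ∀ k, o + n ≤ k → k < n + n → G * pin (.d k) false = G)
    (hQd : ∀ k, n ≤ k → k < n + n → pin (.d k) false * Q = Q) :
    G * ((upperNodes o p).map (w.node n)).prod * Q
      = (w.a₂ * w.a₃) ^ (∑ i ∈ Finset.range (p + 1), i)
        • (G * ((upperNodes o p).map (w.hv n)).prod * Q) := by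
  induction p generalizing o G with
  | zero => simp [upperNodes]
  | succ p ih =>
    set r := ((row o (p + 1)).map (w.hv n)).prod with hr
    set upper := ((upperNodes (o + 1) p).map (w.node n)).prod with hupper
    set b := below (w.hd (o + n)) (w.vd n (o + n)) o (p + 1) with hb
    have pin_h : pin (.h o) false * (upper * Q) = upper * Q :=
      mul_mul_eq_of_commute_left (commute_pin_node <| by grind [mem_upperNodes]) (hQ o (by omega))
    have pin_d : pin (.d (o + n)) false * (upper * Q) = upper * Q :=
      mul_mul_eq_of_commute_left (commute_pin_node <| by grind [mem_upperNodes])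
        (hQd _ (by omega) (by omega))
    have hG' (k : ℕ) (h : o + 1 + n ≤ k) (hk : k < n + n) :
        G * b * r * pin (.d k) false = G * b * r :=
      mul_mul_eq_of_commute_right (commute_pin_hv (by simp)) <|
        mul_mul_eq_of_commute_right (commute_pin_below (by simp; omega) (by simp))
          (hG k (by omega) hk)
    calc G * ((upperNodes o (p + 1)).map (w.node n)).prod * Q
      _ = G * (((row o (p + 1)).map (w.node n)).prod * (upper * Q)) := by
        rw [upperNodes, List.map_append, List.prod_append]
        simp only [mul_assoc, hupper]
      _ = G * b * r * upper * Q := by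
        rw [hw.row_node_mul_eq hop pin_h pin_d]
        simp only [mul_assoc, hb, hr]
      _ = (w.a₂ * w.a₃) ^ (∑ i ∈ Finset.range (p + 1), i)
          • (G * b * ((upperNodes o (p + 1)).map (w.hv n)).prod * Q) := by
        rw [ih (by omega) hG', upperNodes, List.map_append, List.prod_append]
        simp only [mul_assoc, hr]
      _ = _ := by
        rw [below_mul_upper hQ hQ' hw hop (hG _ le_rfl (by omega)) (hQd _ (by omega) (by omega)),
          smul_smul, ← pow_add, ← Finset.sum_range_succ]

end Upper

theorem lower_node_mul_upper_node (hw : w.Compatible) {L Q : Module.End ℂ (State → ℂ)}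
    (hLh : ∀ i, L * pin (.h i) true = L) (hLv : ∀ i, L * pin (.v i) true = L)
    (hLd : ∀ k, L * pin (.d k) (decide (0 < k ∧ k < n)) = L)
    (hQh : ∀ i < n, pin (.h i) false * Q = Q) (hQv : ∀ i < n, pin (.v i) false * Q = Q)
    (hQd : ∀ k < n + n, pin (.d k) (decide (0 < k ∧ k < n)) * Q = Q) :
    L * ((lowerNodes n ++ upperNodes 0 n).map (w.node n)).prod * Q
      = (w.a₂ * w.a₃) ^ n ^ 2
        • (L * ((lowerNodes n ++ upperNodes 0 n).map (w.hv n)).prod * Q) := by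
  have sum_eq : (∑ i ∈ Finset.range n, i) + ∑ i ∈ Finset.range (n + 1), i = n ^ 2 := by
    rw [Finset.sum_range_succ, ← add_assoc, ← mul_two, Finset.sum_range_id_mul_two]
    cases n <;> simp; ring
  have empty (k : ℕ) (hk : n ≤ k) : decide (0 < k ∧ k < n) = false := by simp; omega
  have full (k : ℕ) (h₀ : 0 < k) (hk : k < n) : decide (0 < k ∧ k < n) = true := by simp [h₀, hk]
  have hQd_full (k : ℕ) (h₀ : 0 < k) (hk : k < n) : pin (.d k) true * Q = Q := by
    rw [← full k h₀ hk, hQd k (by omega)]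
  have hLd_empty (k : ℕ) (hk : n ≤ k) : L * pin (.d k) false = L := by
    rw [← empty k hk, hLd k]
  simp only [List.map_append, List.prod_append, ← mul_assoc]
  rw [mul_assoc _ _ Q, lower_node_mul hLh hLv hw le_rfl (fun k h₀ hk => full k h₀ hk ▸ hLd k)
      fun k h₀ hk => mul_mul_eq_of_commute_left (commute_pin_node <| by grind [mem_upperNodes])
        (hQd_full k h₀ hk), ← mul_assoc,
    mul_upper_node hQh hQv hw (zero_add n)
      (fun k hk _ => mul_mul_eq_of_commute_right (commute_pin_hv (by simp))
        (hLd_empty k (by omega)))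
      fun k hk hk' => empty k hk ▸ hQd k hk', smul_smul, ← pow_add, sum_eq]

end Weights

section PartitionFunction

/-- The order of the nodes in which the transfer operators are applied. -/
def Before (u v : ℕ × ℕ) : Prop := u.1 + u.2 < v.1 + v.2 ∨ u.1 + u.2 = v.1 + v.2 ∧ u.1 < v.1

theorem row_pairwise_before (o p : ℕ) : (row o p).Pairwise Before :=
  (pairwise_row o p).imp_of_mem fun hu hv huv => by
    rw [mem_row] at hu hv
    exact .inr ⟨by omega, huv.1⟩

theorem lowerNodes_pairwise_before (m : ℕ) : (lowerNodes m).Pairwise Before := by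
  induction m with
  | zero => simp [lowerNodes]
  | succ m ih =>
    rw [lowerNodes_succ, List.pairwise_append]
    refine ⟨ih, row_pairwise_before 0 m, fun u hu v hv => .inl ?_⟩
    rw [mem_lowerNodes] at hu
    rw [mem_row] at hv
    omega

theorem upperNodes_pairwise_before (o p : ℕ) : (upperNodes o p).Pairwise Before := by
  induction p generalizing o with
  | zero => simp [upperNodes]
  | succ p ih =>
    rw [upperNodes, List.pairwise_append]
    refine ⟨row_pairwise_before o _, ih _, fun u hu v hv => .inl ?_⟩
    rw [mem_row] at hu
    rw [mem_upperNodes] at hv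
    omega

/-- The nodes of the square of size `n`, in the order in which the transfer operators are
applied. -/
def nodes (n : ℕ) : List (ℕ × ℕ) := lowerNodes n ++ upperNodes 0 n

theorem mem_nodes {n : ℕ} {u : ℕ × ℕ} : u ∈ nodes n ↔ u.1 < n ∧ u.2 < n := by
  rw [nodes, List.mem_append, mem_lowerNodes, mem_upperNodes]
  omega

theorem nodes_pairwise_before (n : ℕ) : (nodes n).Pairwise Before := by
  refine List.pairwise_append.2
    ⟨lowerNodes_pairwise_before n, upperNodes_pairwise_before 0 n, fun u hu v hv => .inl ?_⟩
  rw [mem_lowerNodes] at hu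
  rw [mem_upperNodes] at hv
  omega

/-- The state of the lines at their left, lower and upper left ends. -/
def initialState (δ : ℕ → Bool) : State
  | .h _ => true
  | .v _ => true
  | .d k => δ k

open scoped Classical in
/-- The indicator function of the states that are possible at the other ends of the lines. -/
noncomputable def finalVec (n : ℕ) (δ : ℕ → Bool) (s : State) : ℂ :=
  if (∀ y < n, s (.h y) = false) ∧ (∀ x < n, s (.v x) = false) ∧ ∀ k ≤ n + n, s (.d k) = δ k
  then 1 else 0

variable {n : ℕ}

/-- A weight of the environment of a node in the argument order of `nodeOp`. -/
def Vertex.value (W : Bool → Bool → Bool → Bool → Bool → Bool → ℂ) (u : Vertex) : ℂ :=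
  W (u.inc .hor) (u.out .vert) (u.inc .diag) (u.out .hor) (u.inc .vert) (u.out .diag)

/-- The state after a staircase has passed the node `u`, whose East, North and Southeast edges are
occupied as told by `b`. -/
def pass (u : Fin n × Fin n) (b : Bool × Bool × Bool) (s : State) : State :=
  update (update (update s (.h u.2) b.1) (.v u.1) b.2.1) (.d (u.1 + u.2 + 1)) b.2.2

section Trace

variable (W : ℕ → Bool → Bool → Bool → Bool → Bool → Bool → ℂ) (φ : State → ℂ)

/-- The transfer operator of the node `u` with weights `W x` in the column `x`. -/
noncomputable def transfer (u : ℕ × ℕ) : Module.End ℂ (State → ℂ) :=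
  nodeOp (.h u.2) (.v u.1) (.d (u.1 + u.2 + 1)) (W u.1)

/-- The contribution of the outputs `o` to a product of transfer operators. -/
noncomputable def trace (o : Fin n × Fin n → Bool × Bool × Bool) :
    List (Fin n × Fin n) → State → ℂ
  | [], s => φ s
  | u :: L, s =>
    W u.1 (s (.h u.2)) (s (.v u.1)) (s (.d (u.1 + u.2 + 1))) (o u).1 (o u).2.1 (o u).2.2
      * trace o L (pass u (o u) s)

theorem prod_map_transfer_apply {L : List (Fin n × Fin n)} (hL : L.Nodup)
    (o₀ : Fin n × Fin n → Bool × Bool × Bool) (s : State) :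
    (L.map fun u => transfer W (u.1, u.2)).prod φ s
      = ∑ o : Fin n × Fin n → Bool × Bool × Bool with ∀ v ∉ L, o v = o₀ v, trace W φ o L s := by
  induction L generalizing o₀ s with
  | nil =>
    rw [show ({o | ∀ v ∉ [], o v = o₀ v} : Finset _) = {o₀} by ext; simp [funext_iff]]
    simp [trace]
  | cons u L ih =>
    rw [List.nodup_cons] at hL
    have fiber (b : Bool × Bool × Bool) :
        ({o | ∀ v ∉ u :: L, o v = o₀ v} : Finset (Fin n × Fin n → _)).filter (fun o => o u = b)
          = ({o | ∀ v ∉ L, o v = update o₀ u b v} : Finset _) := by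
      ext o
      simp only [Finset.mem_filter, List.mem_cons, update_apply]
      grind
    rw [← Finset.sum_fiberwise _ fun o => o u]
    rw [List.map_cons, List.prod_cons, Module.End.mul_apply, transfer, nodeOp_apply]
    simp only [Fintype.sum_prod_type, fiber]
    refine Finset.sum_congr rfl fun p _ => Finset.sum_congr rfl fun q _ =>
      Finset.sum_congr rfl fun r _ => ?_
    rw [ih hL.2 (update o₀ u (p, q, r)), Finset.mul_sum]
    refine Finset.sum_congr rfl fun o ho => ?_
    have hou : o u = (p, q, r) := by
      rw [(Finset.mem_filter_univ _).1 ho u hL.1, update_self]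
    rw [trace, hou, pass]

end Trace

namespace EdgeConfig

/-- The occupations of the East, North and Southeast edges of the nodes. -/
def outputs (c : EdgeConfig n) (u : Fin n × Fin n) : Bool × Bool × Bool :=
  (c.h u.1.succ u.2, c.v u.1 u.2.succ, c.d u.1.succ u.2.castSucc)

/-- The state `s` is that of `c` along a staircase with the nodes of `L` on its upper right. -/
structure Reads (c : EdgeConfig n) (L : List (Fin n × Fin n)) (s : State) : Prop where
  h : ∀ i y, (∀ x, (x, y) ∈ L ↔ i ≤ x.castSucc) → s (.h y) = c.h i y
  v : ∀ x j, (∀ y, (x, y) ∈ L ↔ j ≤ y.castSucc) → s (.v x) = c.v x j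
  d : ∀ i j : Fin (n + 1), (∀ x y : Fin n, x.val + y + 1 = i + j → ((x, y) ∈ L ↔ i ≤ x.castSucc)) →
    s (.d (i + j)) = c.d i j

/-- The boundary conditions at the ends of the lines where the transfer operators start. -/
structure InitialBoundary (δ : ℕ → Bool) (c : EdgeConfig n) : Prop where
  left : ∀ y, c.h 0 y = true
  bottom : ∀ x, c.v x 0 = true
  left_diag : ∀ j : Fin (n + 1), c.d 0 j = δ j
  top_diag : ∀ i : Fin (n + 1), c.d i (Fin.last n) = δ (i + n)

/-- The boundary conditions at the ends of the lines where the transfer operators stop. -/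
structure FinalBoundary (δ : ℕ → Bool) (c : EdgeConfig n) : Prop where
  right : ∀ y, c.h (Fin.last n) y = false
  top : ∀ x, c.v x (Fin.last n) = false
  right_diag : ∀ j : Fin (n + 1), c.d (Fin.last n) j = δ (n + j)
  bottom_diag : ∀ i : Fin (n + 1), c.d i 0 = δ i

/-- The domain wall boundary conditions, where `δ k` is the occupation of the first and last edges
of the diagonal `k`. -/
structure Boundary (δ : ℕ → Bool) (c : EdgeConfig n) : Prop where
  square : c.SquareDWBC
  diag : ∀ i j, i = 0 ∨ i = Fin.last n ∨ j = 0 ∨ j = Fin.last n → c.d i j = δ (i + j)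

theorem boundary_iff {δ : ℕ → Bool} {c : EdgeConfig n} :
    c.Boundary δ ↔ c.InitialBoundary δ ∧ c.FinalBoundary δ := by
  constructor
  · intro h
    exact ⟨⟨h.square.left, h.square.bottom, fun j => by simpa using h.diag 0 j (by simp),
      fun i => by simpa using h.diag i (Fin.last n) (by simp)⟩, h.square.right, h.square.top,
      fun j => by simpa using h.diag (Fin.last n) j (by simp),
      fun i => by simpa using h.diag i 0 (by simp)⟩
  · rintro ⟨hI, hF⟩
    refine ⟨⟨hI.left, hF.right, hI.bottom, hF.top⟩, ?_⟩
    rintro i j (rfl | rfl | rfl | rfl)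
    · simpa using hI.left_diag j
    · simpa using hF.right_diag j
    · simpa using hF.bottom_diag i
    · simpa using hI.top_diag i

namespace Reads

variable {c : EdgeConfig n} {L : List (Fin n × Fin n)} {s : State} {u : Fin n × Fin n}

theorem initial {δ : ℕ → Bool} (hc : c.InitialBoundary δ) (hL : ∀ u, u ∈ L) :
    c.Reads L (initialState δ) where
  h i y hi := by
    obtain rfl : i = 0 := by
      by_contra h₀
      have := i.isLt
      have := (hi ⟨0, y.pos⟩).1 (hL _)
      exact h₀ (Fin.le_zero_iff.1 this)
    exact (hc.left y).symm
  v x j hj := by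
    obtain rfl : j = 0 := by
      by_contra h₀
      exact h₀ (Fin.le_zero_iff.1 ((hj ⟨0, x.pos⟩).1 (hL _)))
    exact (hc.bottom x).symm
  d i j hij := by
    simp only [hL, true_iff, Fin.le_def, Fin.val_castSucc] at hij
    rcases Fin.eq_zero_or_eq_succ i with rfl | ⟨x, rfl⟩
    · simpa [initialState] using (hc.left_diag j).symm
    rcases Fin.eq_castSucc_or_eq_last j with ⟨y, rfl⟩ | rfl
    · have := hij x y (by simp; omega)
      simp at this
    · simpa [initialState] using (hc.top_diag x.succ).symm

theorem finalVec_apply {δ : ℕ → Bool} [Decidable (c.FinalBoundary δ)] (hs : c.Reads [] s) :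
    finalVec n δ s = if c.FinalBoundary δ then 1 else 0 := by
  have hh (y : Fin n) : s (.h y) = c.h (Fin.last n) y := hs.h _ _ (by simp)
  have hv (x : Fin n) : s (.v x) = c.v x (Fin.last n) := hs.v _ _ (by simp)
  have hd (j : Fin (n + 1)) : s (.d (n + j)) = c.d (Fin.last n) j := by
    simpa using hs.d (Fin.last n) j (by simp)
  have hd' (i : Fin (n + 1)) : s (.d i) = c.d i 0 := by
    refine hs.d i 0 fun x y hxy => ?_
    simp only [List.not_mem_nil, false_iff, Fin.le_def, Fin.val_castSucc]
    simp at hxy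
    omega
  unfold finalVec
  refine if_congr ⟨fun h => ⟨fun y => hh y ▸ h.1 y y.isLt, fun x => hv x ▸ h.2.1 x x.isLt,
    fun j => hd j ▸ h.2.2 _ (by omega), fun i => hd' i ▸ h.2.2 _ (by omega)⟩,
    fun h => ⟨fun y hy => hh ⟨y, hy⟩ ▸ h.right _, fun x hx => hv ⟨x, hx⟩ ▸ h.top _,
      fun k hk => ?_⟩⟩ rfl rfl
  rcases lt_or_ge k (n + 1) with hkn | hkn
  · exact hd' ⟨k, hkn⟩ ▸ h.bottom_diag _
  · obtain ⟨j, rfl⟩ := Nat.exists_eq_add_of_le (show n ≤ k by omega)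
    exact hd ⟨j, by omega⟩ ▸ h.right_diag _

variable (hs : c.Reads (u :: L) s) (hL : ∀ v : Fin n × Fin n, v ∈ L ↔ Before (u.1, u.2) (v.1, v.2))
include hs hL

theorem head_h : s (.h u.2) = c.h u.1.castSucc u.2 := by
  refine hs.h _ _ fun x => ?_
  simp only [List.mem_cons, hL, Before, Prod.ext_iff, Fin.ext_iff, Fin.le_def, Fin.val_castSucc,
    and_true]
  omega

theorem head_v : s (.v u.1) = c.v u.1 u.2.castSucc := by
  refine hs.v _ _ fun x => ?_
  simp only [List.mem_cons, hL, Before, Prod.ext_iff, Fin.ext_iff, Fin.le_def, Fin.val_castSucc,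
    true_and]
  omega

theorem head_d : s (.d (u.1 + u.2 + 1)) = c.d u.1.castSucc u.2.succ := by
  refine hs.d u.1.castSucc u.2.succ fun x y hxy => ?_
  simp only [Fin.val_castSucc, Fin.val_succ] at hxy
  simp only [List.mem_cons, hL, Before, Prod.ext_iff, Fin.ext_iff, Fin.le_def, Fin.val_castSucc]
  omega

theorem pass : c.Reads L (pass u (c.outputs u) s) where
  h i y hi := by
    simp only [TwentyVertex.pass, outputs, update_apply, reduceCtorEq, if_false, Line.h.injEq]
    split_ifs with hy
    · obtain rfl : y = u.2 := Fin.ext hy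
      suffices i = u.1.succ by rw [this]
      simp only [hL, Before, Fin.le_def, Fin.ext_iff, Fin.val_castSucc, Fin.val_succ] at hi ⊢
      have h₁ := hi u.1
      have h₂ (h : u.1 + 1 < n) := hi ⟨u.1 + 1, h⟩
      dsimp only at h₂
      omega
    · exact hs.h i y fun x => by rw [← hi, List.mem_cons]; grind
  v x j hj := by
    simp only [TwentyVertex.pass, outputs, update_apply, reduceCtorEq, if_false, Line.v.injEq]
    split_ifs with hx
    · obtain rfl : x = u.1 := Fin.ext hx
      suffices j = u.2.succ by rw [this]
      simp only [hL, Before, Fin.le_def, Fin.ext_iff, Fin.val_castSucc, Fin.val_succ] at hj ⊢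
      have h₁ := hj u.2
      have h₂ (h : u.2 + 1 < n) := hj ⟨u.2 + 1, h⟩
      dsimp only at h₂
      omega
    · exact hs.v x j fun y => by rw [← hj, List.mem_cons]; grind
  d i j hij := by
    simp only [TwentyVertex.pass, outputs, update_apply, reduceCtorEq, if_false, Line.d.injEq]
    split_ifs with hx
    · have h₁ := hij u.1 u.2 hx.symm
      have h₂ (h : u.1 + 1 < n) (h' : 0 < u.2.val) := hij ⟨u.1 + 1, h⟩ ⟨u.2 - 1, by omega⟩
      simp only [hL, Before, Fin.le_def, Fin.val_castSucc] at h₁ h₂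
      obtain rfl : i = u.1.succ := Fin.ext (by simp only [Fin.val_succ]; omega)
      obtain rfl : j = u.2.castSucc := Fin.ext (by simp at hx ⊢; omega)
      rfl
    · exact hs.d i j fun x y hxy => by rw [← hij x y hxy, List.mem_cons]; grind

end Reads

variable (W : ℕ → Bool → Bool → Bool → Bool → Bool → Bool → ℂ) {δ : ℕ → Bool}

open scoped Classical in
theorem trace_outputs {c : EdgeConfig n} {L : List (Fin n × Fin n)} {s : State}
    (hs : c.Reads L s) (hL : L.Pairwise fun u v => Before (u.1, u.2) (v.1, v.2))
    (hL' : ∀ u ∈ L, ∀ v : Fin n × Fin n, Before (u.1, u.2) (v.1, v.2) → v ∈ L) :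
    trace W (finalVec n δ) c.outputs L s
      = (L.map fun u => (c.vertex u.1 u.2).value (W u.1)).prod
        * if c.FinalBoundary δ then 1 else 0 := by
  induction L generalizing s with
  | nil => simp [trace, hs.finalVec_apply]
  | cons u L ih =>
    rw [List.pairwise_cons] at hL
    have mem_iff (v : Fin n × Fin n) : v ∈ L ↔ Before (u.1, u.2) (v.1, v.2) := by
      refine ⟨hL.1 v, fun huv => (List.mem_cons.1 (hL' u (by simp) v huv)).resolve_left ?_⟩
      rintro rfl
      simp [Before] at huv
    have closed (u' : Fin n × Fin n) (hu' : u' ∈ L) (v : Fin n × Fin n)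
        (h : Before (u'.1, u'.2) (v.1, v.2)) : v ∈ L := by
      simp only [mem_iff, Before] at hu' h ⊢
      omega
    rw [trace, ih (hs.pass mem_iff) hL.2 closed, hs.head_h mem_iff, hs.head_v mem_iff,
      hs.head_d mem_iff, List.map_cons, List.prod_cons, mul_assoc]
    rfl

/-- The configuration with given occupations of the East, North and Southeast edges of the nodes
and given initial boundary conditions. -/
def ofOutputs (δ : ℕ → Bool) (o : Fin n × Fin n → Bool × Bool × Bool) : EdgeConfig n where
  h i y := Fin.cases true (fun x => (o (x, y)).1) i
  v x j := Fin.cases true (fun y => (o (x, y)).2.1) j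
  d i j := Fin.cases (δ j) (fun x => Fin.lastCases (δ (x + 1 + n)) (fun y => (o (x, y)).2.2) j) i

theorem outputs_ofOutputs (o : Fin n × Fin n → Bool × Bool × Bool) :
    (ofOutputs δ o).outputs = o := by
  funext u
  simp [outputs, ofOutputs]

theorem initialBoundary_ofOutputs (o : Fin n × Fin n → Bool × Bool × Bool) :
    (ofOutputs δ o).InitialBoundary δ where
  left y := rfl
  bottom x := rfl
  left_diag j := rfl
  top_diag i := by cases i using Fin.cases <;> simp [ofOutputs]

theorem InitialBoundary.ofOutputs_outputs {c : EdgeConfig n} (hc : c.InitialBoundary δ) :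
    ofOutputs δ c.outputs = c := by
  ext i j
  · cases i using Fin.cases <;> simp [ofOutputs, outputs, hc.left]
  · cases j using Fin.cases <;> simp [ofOutputs, outputs, hc.bottom]
  · cases i using Fin.cases with
    | zero => simp [ofOutputs, hc.left_diag]
    | succ x => cases j using Fin.lastCases <;> simp [ofOutputs, outputs, hc.top_diag]

open scoped Classical in
theorem sum_boundary_prod_value : ∑ c : EdgeConfig n with c.Boundary δ,
      ∏ x, ∏ y, (c.vertex x y).value (W x)
    = ((nodes n).map (transfer W)).prod (finalVec n δ) (initialState δ) := by
  obtain ⟨L, hL⟩ : nodes n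
      ∈ Set.range (List.map fun u : Fin n × Fin n => ((u.1 : ℕ), (u.2 : ℕ))) := by
    rw [Set.range_list_map]
    exact fun u hu => ⟨(⟨u.1, (mem_nodes.1 hu).1⟩, ⟨u.2, (mem_nodes.1 hu).2⟩), rfl⟩
  have pairwise : L.Pairwise fun u v => Before (u.1, u.2) (v.1, v.2) :=
    List.pairwise_map.1 (hL ▸ nodes_pairwise_before n)
  have mem (u : Fin n × Fin n) : u ∈ L := by
    have hu : ((u.1 : ℕ), (u.2 : ℕ)) ∈ nodes n := mem_nodes.2 ⟨u.1.isLt, u.2.isLt⟩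
    simpa [← hL, ← Fin.ext_iff] using hu
  have nodup : L.Nodup := pairwise.imp fun h => by
    rintro rfl
    simp [Before] at h
  have prod_eq (c : EdgeConfig n) : (L.map fun u => (c.vertex u.1 u.2).value (W u.1)).prod
      = ∏ x, ∏ y, (c.vertex x y).value (W x) := by
    rw [← List.prod_toFinset _ nodup, Finset.eq_univ_of_forall fun u => List.mem_toFinset.2 (mem u),
      Fintype.prod_prod_type]
  calc ∑ c : EdgeConfig n with c.Boundary δ, ∏ x, ∏ y, (c.vertex x y).value (W x)
    _ = ∑ c : EdgeConfig n with c.InitialBoundary δ,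
        trace W (finalVec n δ) c.outputs L (initialState δ) := by
      simp only [boundary_iff, ← Finset.filter_filter]
      rw [Finset.sum_filter]
      refine Finset.sum_congr rfl fun c hc => ?_
      rw [trace_outputs W (.initial ((Finset.mem_filter_univ _).1 hc) mem) pairwise
        fun _ _ v _ => mem v, prod_eq, mul_ite, mul_one, mul_zero]
    _ = ∑ o, trace W (finalVec n δ) o L (initialState δ) :=
      Finset.sum_nbij' outputs (ofOutputs δ) (by simp) (by simp [initialBoundary_ofOutputs])
        (fun c hc => ((Finset.mem_filter_univ _).1 hc).ofOutputs_outputs)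
        (fun o _ => outputs_ofOutputs o) fun _ _ => rfl
    _ = (L.map fun u => transfer W (u.1, u.2)).prod (finalVec n δ) (initialState δ) := by
      rw [prod_map_transfer_apply W _ nodup fun _ => default]
      simp [mem]
    _ = ((nodes n).map (transfer W)).prod (finalVec n δ) (initialState δ) := by
      rw [← hL, List.map_map]
      rfl

end EdgeConfig

/-- The occupation of the first and last edges of the diagonals under the boundary conditions
DWBC2. -/
def diagBoundary (n k : ℕ) : Bool := decide (0 < k ∧ k < n)

theorem Weights.Compatible.prod_node_apply {w : Weights} (hw : w.Compatible) :
    ((nodes n).map (w.node n)).prod (finalVec n (diagBoundary n)) (initialState (diagBoundary n))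
      = (w.a₂ * w.a₃) ^ n ^ 2
        * ((nodes n).map (w.hv n)).prod (finalVec n (diagBoundary n))
          (initialState (diagBoundary n)) := by
  classical
  let L : Module.End ℂ (State → ℂ) :=
    LinearMap.mulLeft ℂ fun s => if s = initialState (diagBoundary n) then 1 else 0
  let Q : Module.End ℂ (State → ℂ) := LinearMap.mulLeft ℂ (finalVec n (diagBoundary n))
  have L_pin (i : Line) : L * pin i (initialState (diagBoundary n) i) = L := by
    refine LinearMap.ext fun φ => funext fun s => ?_
    by_cases hs : s = initialState (diagBoundary n) <;> simp [L, pin_apply, hs]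
  have pin_Q (i : Line) (b : Bool) (h : ∀ s, finalVec n (diagBoundary n) s ≠ 0 → s i = b) :
      pin i b * Q = Q := by
    refine LinearMap.ext fun φ => funext fun s => ?_
    by_cases hs : s i = b
    · simp [pin_apply, hs]
    · simp [Q, pin_apply, hs, not_imp_comm.1 (h s) hs]
  have unravel := Weights.lower_node_mul_upper_node hw
    (fun i => L_pin (.h i)) (fun i => L_pin (.v i))
    (fun k => L_pin (.d k)) (fun i hi => pin_Q _ _ fun s hs => ?_)
    (fun i hi => pin_Q _ _ fun s hs => ?_) fun k hk => pin_Q _ _ fun s hs => ?_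
  · simpa [L, Q, nodes] using congr($unravel 1 (initialState (diagBoundary n)))
  all_goals
    simp only [finalVec, ne_eq, ite_eq_right_iff, one_ne_zero, imp_false, not_not] at hs
  · exact hs.1 i hi
  · exact hs.2.1 i hi
  · exact hs.2.2 k hk.le

end PartitionFunction

section UppermostPath

namespace EdgeConfig

variable {n : ℕ} {c : EdgeConfig n}

theorem UppermostEnters.inc {x y : Fin n} {s : Step} (h : c.UppermostEnters x y s) :
    (c.vertex x y).inc s = true := by
  cases h with
  | start _ _ _ _ h => exact h
  | next _ _ _ _ _ _ _ hl h =>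
    rw [← hl.2.1]
    cases s with
    | hor =>
      obtain ⟨hx, rfl⟩ := h
      exact congrArg (c.h · _) (Fin.ext hx)
    | diag => exact congrArg₂ c.d (Fin.ext h.1) (Fin.ext h.2)
    | vert =>
      obtain ⟨rfl, hy⟩ := h
      exact congrArg (c.v _) (Fin.ext hy)

/-- The ice rule and the boundary conditions shared by the 20V and the 6V models. -/
structure IsDomainWall (c : EdgeConfig n) : Prop where
  ice : ∀ x y, (c.vertex x y).Ice
  square : c.SquareDWBC
  right_diag : ∀ j, c.d (Fin.last n) j = false
  top_diag : ∀ i, c.d i (Fin.last n) = false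

theorem IsTwentyV.isDomainWall (hc : c.IsTwentyV) : c.IsDomainWall :=
  ⟨hc.ice, hc.square, hc.right_diag, hc.top_diag⟩

theorem IsSixV.isDomainWall (hc : c.IsSixV) : c.IsDomainWall :=
  ⟨hc.ice, hc.square, hc.no_diag _, fun i => hc.no_diag i _⟩

/-- The uppermost path enters the node `(x, y)` by a step `s`, and no other path enters this node
above it or leaves the column `x` higher than at `(x, y)`. -/
structure TopEntry (c : EdgeConfig n) (x y : Fin n) (s : Step) : Prop where
  enters : c.UppermostEnters x y s
  incAbove : (c.vertex x y).incAbove s = 0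
  hor_above : ∀ y', y < y' → c.h x.succ y' = false
  diag_above : ∀ j : Fin (n + 1), y.val < j → c.d x.succ j = false

namespace IsDomainWall

variable (hc : c.IsDomainWall)
include hc

theorem ice_eq (x y : Fin n) :
    (c.h x.castSucc y).toNat + (c.d x.castSucc y.succ).toNat + (c.v x y.succ).toNat
      = (c.h x.succ y).toNat + (c.d x.succ y.castSucc).toNat + (c.v x y.castSucc).toNat :=
  hc.ice x y

theorem empty_column {x : Fin n} {Y : ℕ} (hh : ∀ y : Fin n, Y ≤ y → c.h x.castSucc y = false)
    (hd : ∀ j : Fin (n + 1), Y < j → c.d x.castSucc j = false) :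
    (∀ j : Fin (n + 1), Y ≤ j → c.v x j = false) ∧
      (∀ y : Fin n, Y ≤ y → c.h x.succ y = false) ∧
      ∀ j : Fin (n + 1), Y ≤ j → c.d x.succ j = false := by
  have step (y : Fin n) (hy : Y ≤ y) (hv : c.v x y.succ = false) :
      c.v x y.castSucc = false ∧ c.h x.succ y = false ∧ c.d x.succ y.castSucc = false := by
    have e := hc.ice_eq x y
    rw [hh y hy, hd y.succ (by simp; omega), hv] at e
    simp only [Bool.toNat_false] at e
    refine ⟨?_, ?_, ?_⟩ <;> rw [← Bool.toNat_eq_zero] <;> omega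
  have hv (j : Fin (n + 1)) : Y ≤ j → c.v x j = false := by
    induction j using Fin.reverseInduction with
    | last => exact fun _ => hc.square.top x
    | cast y ih => exact fun hy => (step y hy (ih (by simp at hy ⊢; omega))).1
  refine ⟨hv, fun y hy => (step y hy (hv _ (by simp; omega))).2.1, fun j => ?_⟩
  cases j using Fin.lastCases with
  | last => exact fun _ => hc.top_diag _
  | cast y => exact fun hy => (step y hy (hv _ (by simp at hy ⊢; omega))).2.2

theorem topEntry_start {x y : Fin n} (hx : x.val = 0) (hy : y.val + 1 = n) :
    c.TopEntry x y .hor := by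
  have hx' : x.castSucc = 0 := Fin.ext hx
  have hy' : y.succ = Fin.last n := Fin.ext hy
  refine ⟨.start x y hx hy (hx' ▸ hc.square.left y), ?_, fun y' h => ?_, fun j h => ?_⟩
  · simp [Vertex.incAbove, vertex, hy', hc.square.top, hc.top_diag]
  · omega
  · rw [show j = Fin.last n from Fin.ext (by simp; omega), hc.top_diag]

section Step

variable {x y : Fin n} {s : Step} (h : c.TopEntry x y s)
include h

theorem topEntry_hor (ho : c.h x.succ y = true) {x' : Fin n} (hx : x'.val = x.val + 1) :
    c.TopEntry x' y .hor := by
  have hx' : x'.castSucc = x.succ := Fin.ext hx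
  obtain ⟨col_v, col_h, col_d⟩ := hc.empty_column (x := x') (Y := y + 1)
    (fun y' hy => hx' ▸ h.hor_above y' hy) (fun j hj => hx' ▸ h.diag_above j (by omega))
  refine ⟨.next x y s .hor x' y h.enters ⟨h.enters.inc, ho, h.incAbove⟩ ⟨hx, rfl⟩, ?_, col_h, col_d⟩
  simp [Vertex.incAbove, vertex, hx', h.diag_above y.succ (by simp), col_v y.succ (by simp)]

theorem topEntry_next_column_empty (ho : c.h x.succ y = false) {x' : Fin n}
    (hx : x'.val = x.val + 1) : (∀ j : Fin (n + 1), y.val ≤ j → c.v x' j = false) ∧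
      (∀ z : Fin n, y.val ≤ z → c.h x'.succ z = false) ∧
      ∀ j : Fin (n + 1), y.val ≤ j → c.d x'.succ j = false := by
  have hx' : x'.castSucc = x.succ := Fin.ext hx
  exact hc.empty_column
    (fun z hz => hx' ▸ (Fin.le_def.2 hz).eq_or_lt.elim (fun e => e ▸ ho) (h.hor_above z))
    (fun j hj => hx' ▸ h.diag_above j hj)

theorem topEntry_diag (ho : c.h x.succ y = false) (hd : c.d x.succ y.castSucc = true)
    {x' y' : Fin n} (hx : x'.val = x.val + 1) (hy : y'.val + 1 = y) : c.TopEntry x' y' .diag := by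
  have hy' : y'.succ = y.castSucc := Fin.ext hy
  obtain ⟨col_v, col_h, col_d⟩ := hc.topEntry_next_column_empty h ho hx
  refine ⟨.next x y s .diag x' y' h.enters ⟨h.enters.inc, hd, ?_⟩ ⟨hx, hy⟩, ?_,
    fun z hz => col_h z (by omega), fun j hj => col_d j (by omega)⟩
  · simpa [Vertex.outAbove, vertex, ho] using h.incAbove
  · simp [Vertex.incAbove, vertex, hy', col_v y.castSucc (by simp)]

theorem topEntry_vert (ho : c.h x.succ y = false) (hd : c.d x.succ y.castSucc = false)
    {y' : Fin n} (hy : y'.val + 1 = y) : c.TopEntry x y' .vert := by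
  have hv : c.v x y.castSucc = true := by
    have ice := hc.ice_eq x y
    have inc := h.enters.inc
    rw [ho, hd] at ice
    cases s <;> simp only [vertex] at inc <;> rw [inc] at ice <;>
      cases hS : c.v x y.castSucc <;> simp [hS] at ice ⊢
  refine ⟨.next x y s .vert x y' h.enters ⟨h.enters.inc, hv, ?_⟩ ⟨rfl, hy⟩, rfl,
    fun z hz => ?_, fun j hj => ?_⟩
  · simpa [Vertex.outAbove, vertex, ho, hd] using h.incAbove
  · rcases eq_or_lt_of_le (show y ≤ z by omega) with rfl | hz
    exacts [ho, h.hor_above z hz]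
  · rcases eq_or_lt_of_le (show y.castSucc ≤ j by simp [Fin.le_def]; omega) with rfl | hj
    exacts [hd, h.diag_above j hj]

theorem exists_hitsRight_of_topEntry (hlast : x.val + 1 = n → s ≠ .vert) :
    ∃ y s, c.HitsRight y s := by
  induction hm : n - x + y using Nat.strong_induction_on generalizing x y s with
  | _ m ih =>
    by_cases hx : x.val + 1 = n
    · exact ⟨y, s, hlast hx, x, hx, h.enters⟩
    obtain ⟨x', hx'⟩ : ∃ x' : Fin n, x'.val = x.val + 1 := ⟨⟨x + 1, by omega⟩, rfl⟩
    cases ho : c.h x.succ y with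
    | true => exact ih _ (by omega) (hc.topEntry_hor h ho hx') (by simp) rfl
    | false =>
      have hy : 0 < y.val := by
        by_contra hy
        obtain ⟨col_v, -⟩ := hc.topEntry_next_column_empty h ho hx'
        simpa [hc.square.bottom x'] using col_v 0 (by simp; omega)
      obtain ⟨y', hy'⟩ : ∃ y' : Fin n, y'.val + 1 = y.val := ⟨⟨y - 1, by omega⟩, by simp; omega⟩
      cases hd : c.d x.succ y.castSucc with
      | true => exact ih _ (by omega) (hc.topEntry_diag h ho hd hx' hy') (by simp) rfl
      | false => exact ih _ (by omega) (hc.topEntry_vert h ho hd hy') (absurd · hx) rfl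

end Step

theorem exists_hitsRight (hn : 0 < n) : ∃ y s, c.HitsRight y s :=
  hc.exists_hitsRight_of_topEntry
    (hc.topEntry_start (x := ⟨0, hn⟩) (y := ⟨n - 1, by omega⟩) rfl (by simp; omega)) (by simp)

section LastColumn

variable {x : Fin n} (hx : x.val + 1 = n)
include hx

theorem last_column_ice (y : Fin n) :
    (c.h x.castSucc y).toNat + (c.d x.castSucc y.succ).toNat + (c.v x y.succ).toNat
      = (c.v x y.castSucc).toNat := by
  have hl : x.succ = Fin.last n := Fin.ext hx
  simpa [hl, hc.square.right, hc.right_diag] using hc.ice_eq x y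

theorem last_column_v_antitone : Antitone (c.v x) := by
  refine Fin.antitone_iff_succ_le.2 fun y => ?_
  have ice := hc.last_column_ice hx y
  cases hN : c.v x y.succ <;> cases hS : c.v x y.castSucc <;> simp [hN, hS] at ice ⊢

theorem last_column_of_hit {y : Fin n} {s : Step} (hs : s ≠ .vert)
    (hi : (c.vertex x y).inc s = true) :
    c.h x.castSucc y = decide (s = .hor) ∧ c.d x.castSucc y.succ = decide (s = .diag) ∧
      c.v x y.succ = false ∧ c.v x y.castSucc = true := by
  have ice := hc.last_column_ice hx y
  cases s <;> simp only [vertex] at hi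
  · cases hI : c.d x.castSucc y.succ <;> cases hN : c.v x y.succ <;>
      cases hS : c.v x y.castSucc <;> simp [hi, hI, hN, hS] at ice ⊢
  · cases hW : c.h x.castSucc y <;> cases hN : c.v x y.succ <;>
      cases hS : c.v x y.castSucc <;> simp [hi, hW, hN, hS] at ice ⊢
  · exact absurd rfl hs

theorem last_column {y : Fin n} {s : Step} (h : c.HitsRight y s) (z : Fin n) :
    c.h x.castSucc z = decide (z = y ∧ s = .hor) ∧
      c.d x.castSucc z.succ = decide (z = y ∧ s = .diag) ∧ c.v x z.succ = decide (z < y) := by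
  obtain ⟨hs, x', hx', h⟩ := h
  obtain rfl : x = x' := Fin.ext (by omega)
  obtain ⟨hW, hI, hN, hS⟩ := hc.last_column_of_hit hx hs h.inc
  have anti := hc.last_column_v_antitone hx
  have ice := hc.last_column_ice hx z
  rcases lt_trichotomy z y with hz | rfl | hz
  · have hN' : c.v x z.succ = true := by
      have := anti (show z.succ ≤ y.castSucc from hz)
      rw [hS] at this
      exact top_le_iff.1 this
    cases hW' : c.h x.castSucc z <;> cases hI' : c.d x.castSucc z.succ <;>
      cases hS' : c.v x z.castSucc <;> simp [hN', hW', hI', hS', hz, hz.ne] at ice ⊢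
  · simp [hW, hI, hN]
  · have hS' : c.v x z.castSucc = false := by
      have := anti (show y.succ ≤ z.castSucc from hz)
      rw [hN] at this
      exact le_bot_iff.1 this
    cases hW' : c.h x.castSucc z <;> cases hI' : c.d x.castSucc z.succ <;>
      cases hN' : c.v x z.succ <;> simp [hS', hW', hI', hN', hz.le, hz.ne'] at ice ⊢

end LastColumn

theorem hitsRight_unique {y y' : Fin n} {s s' : Step} (h : c.HitsRight y s)
    (h' : c.HitsRight y' s') : y' = y ∧ s' = s := by
  obtain ⟨-, x, hx, -⟩ := id h
  obtain ⟨hW, hI, -⟩ := hc.last_column hx h y'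
  obtain ⟨hW', hI', -⟩ := hc.last_column hx h' y'
  cases s' with
  | hor => simpa [hW, eq_comm (a := s)] using hW'
  | diag => simpa [hI, eq_comm (a := s)] using hI'
  | vert => exact absurd rfl h'.1

end IsDomainWall

/-- The product of the exit factors of the nodes. -/
def exitProd (c : EdgeConfig n) (τ g : ℂ) : ℂ :=
  ∏ x : Fin n, ∏ y : Fin n, exitFactor τ g n x (c.d x.castSucc y.succ) (c.v x y.succ)

namespace IsDomainWall

variable (hc : c.IsDomainWall)
include hc

theorem exitProd_eq {y : Fin n} {s : Step} (h : c.HitsRight y s) (τ g : ℂ) :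
    c.exitProd τ g = τ ^ (y : ℕ) * if s = .diag then g else 1 := by
  obtain ⟨-, x₀, hx₀, -⟩ := id h
  have factor (z : Fin n) : exitFactor τ g n x₀ (c.d x₀.castSucc z.succ) (c.v x₀ z.succ)
      = (if z < y then τ else 1) * if z = y then (if s = .diag then g else 1) else 1 := by
    obtain ⟨-, hI, hN⟩ := hc.last_column hx₀ h z
    rw [exitFactor, if_pos hx₀, hI, hN]
    rcases lt_trichotomy z y with hz | rfl | hz
    · simp [hz, hz.ne]
    · simp
    · simp [hz.ne']
  rw [exitProd, Finset.prod_eq_single x₀]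
  · simp only [factor, Finset.prod_mul_distrib, Finset.prod_ite_eq', Finset.mem_univ, if_true]
    simp [Finset.prod_ite, Finset.filter_gt_eq_Iio]
  · intro x _ hx
    have : x.val + 1 ≠ n := fun h' => hx (Fin.ext (by omega))
    simp [exitFactor, this]
  · simp

open scoped Classical in
theorem sum_hitsRight (hn : 0 < n) (τ g : ℂ) :
    (∑ y : Fin n with c.HitsRight y .hor, τ ^ (y : ℕ))
      + g * ∑ y : Fin n with c.HitsRight y .diag, τ ^ (y : ℕ) = c.exitProd τ g := by
  obtain ⟨y, s, h⟩ := hc.exists_hitsRight hn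
  have hit (s' : Step) :
      ({y' | c.HitsRight y' s'} : Finset (Fin n)) = if s' = s then {y} else ∅ := by
    ext y'
    split_ifs with e
    · simpa using ⟨fun h' => (hc.hitsRight_unique h h').1, fun e' => e ▸ e' ▸ h⟩
    · simpa using fun h' => e (hc.hitsRight_unique h h').2
  rw [hc.exitProd_eq h, hit, hit]
  cases s with
  | hor => simp
  | diag => simp [mul_comm]
  | vert => exact absurd rfl h.1

open scoped Classical in
theorem sum_exists_hitsRight (hn : 0 < n) (τ : ℂ) :
    ∑ y : Fin n with ∃ s, c.HitsRight y s, τ ^ (y : ℕ) = c.exitProd τ 1 := by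
  obtain ⟨y, s, h⟩ := hc.exists_hitsRight hn
  rw [hc.exitProd_eq h, ite_self, mul_one, Finset.sum_eq_single y]
  · intro y' hy' hne
    obtain ⟨s', h'⟩ := (Finset.mem_filter_univ _).1 hy'
    exact absurd (hc.hitsRight_unique h h').1 hne
  · simpa using fun h' => absurd h (h' s)

end IsDomainWall

end EdgeConfig

end UppermostPath

section RefinedSums

open scoped Classical in
theorem sum_sum_filter_mul {α β : Type*} [Fintype α] [Fintype β] (p : α → Prop)
    (r : α → β → Prop) (f : α → ℂ) (g : β → ℂ) :
    ∑ b, (∑ a with p a ∧ r a b, f a) * g b = ∑ a with p a, f a * ∑ b with r a b, g b := by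
  simp only [Finset.sum_filter, Finset.sum_mul, Finset.mul_sum]
  rw [Finset.sum_comm]
  refine Finset.sum_congr rfl fun a _ => ?_
  by_cases h : p a <;> simp [h]

theorem weight20_of_not_ice {ω : Fin 7 → ℂ} {u : Vertex} (h : ¬ u.Ice) : u.weight20 ω = 0 := by
  unfold Vertex.weight20
  unfold Vertex.Ice at h
  generalize u.inc .hor = W, u.inc .diag = I, u.inc .vert = N, u.out .hor = E, u.out .diag = O,
    u.out .vert = S at h ⊢
  cases W <;> cases I <;> cases N <;> cases E <;> cases O <;> cases S <;>
    first
    | rfl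
    | exact absurd rfl h

theorem weight6_of_not_ice {a b c : ℂ} {u : Vertex} (h : ¬ u.Ice)
    (hu : u.out .diag = u.inc .diag) : u.weight6 a b c = 0 := by
  unfold Vertex.weight6
  unfold Vertex.Ice at h
  rw [hu] at h
  generalize u.inc .hor = W, u.inc .diag = I, u.inc .vert = N, u.out .hor = E,
    u.out .vert = S at h ⊢
  cases W <;> cases I <;> cases N <;> cases E <;> cases S <;>
    first
    | rfl
    | exact absurd rfl h

variable {n : ℕ} {c : EdgeConfig n}

theorem prod_prod_eq_zero_of_exists {f : Fin n → Fin n → ℂ} (h : ∃ x y, f x y = 0) :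
    ∏ x, ∏ y, f x y = 0 := by
  obtain ⟨x, y, h⟩ := h
  exact Finset.prod_eq_zero (Finset.mem_univ x) (Finset.prod_eq_zero (Finset.mem_univ y) h)

namespace EdgeConfig

theorem isTwentyV_iff :
    c.IsTwentyV ↔ c.Boundary (diagBoundary n) ∧ ∀ x y, (c.vertex x y).Ice := by
  have inner (k : Fin (n + 1)) (h₀ : k ≠ 0) (hl : k ≠ Fin.last n) : diagBoundary n k = true := by
    rw [ne_eq, Fin.ext_iff] at h₀ hl
    exact decide_eq_true ⟨Nat.pos_of_ne_zero h₀, by simp at hl; omega⟩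
  have outer (k : ℕ) (hk : k = 0 ∨ n ≤ k) : diagBoundary n k = false := by
    simp [diagBoundary]
    omega
  have side (k : Fin (n + 1)) (b : Bool) (h₀ : k = 0 → b = false)
      (hl : k = Fin.last n → b = false) (h : k ≠ 0 → k ≠ Fin.last n → b = true) :
      b = diagBoundary n k := by
    by_cases hk₀ : k = 0
    · rw [h₀ hk₀, outer _ (by simp [hk₀])]
    by_cases hkl : k = Fin.last n
    · rw [hl hkl, outer _ (by simp [hkl])]
    rw [h hk₀ hkl, inner k hk₀ hkl]
  constructor
  · intro h
    refine ⟨⟨h.square, ?_⟩, h.ice⟩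
    rintro i j (rfl | rfl | rfl | rfl)
    · simpa using side j _ (· ▸ h.corner) (· ▸ h.top_diag 0) (h.left_diag j)
    · rw [h.right_diag, outer _ (by simp)]
    · simpa using side i _ (· ▸ h.corner) (· ▸ h.right_diag 0) (h.bottom_diag i)
    · rw [h.top_diag, outer _ (by simp)]
  · rintro ⟨h, ice⟩
    refine ⟨ice, h.square, fun j hj hj' => ?_, fun i hi hi' => ?_, fun j => ?_, fun i => ?_, ?_⟩
    · rw [h.diag 0 j (by simp), Fin.val_zero, zero_add, inner j hj hj']
    · rw [h.diag i 0 (by simp), Fin.val_zero, add_zero, inner i hi hi']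
    · rw [h.diag _ j (by simp), outer _ (by simp)]
    · rw [h.diag i _ (by simp), outer _ (by simp)]
    · rw [h.diag 0 0 (by simp), outer _ (by simp)]

theorem prod_value_nodeWeight (w : Weights) :
    ∏ x, ∏ y, (c.vertex x y).value (w.nodeWeight n x)
      = c.exitProd w.τ w.g * ∏ x, ∏ y, (c.vertex x y).weight20 w.nodeWeights := by
  simp only [exitProd, ← Finset.prod_mul_distrib]
  rfl

end EdgeConfig

open scoped Classical in
theorem Z20_add_eq_sum_boundary (hn : 0 < n) (w : Weights) {η lam μ : ℂ}
    (hω : omega η lam μ = w.nodeWeights) :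
    Z20 n η lam μ .hor w.τ + w.g * Z20 n η lam μ .diag w.τ
      = ∑ c : EdgeConfig n with c.Boundary (diagBoundary n),
          ∏ x, ∏ y, (c.vertex x y).value (w.nodeWeight n x) := by
  have vanish (c : EdgeConfig n) (hB : c.Boundary (diagBoundary n)) (hc : ¬ c.IsTwentyV) :
      ∏ x, ∏ y, (c.vertex x y).weight20 w.nodeWeights = 0 := by
    simp only [EdgeConfig.isTwentyV_iff, hB, true_and, not_forall] at hc
    exact prod_prod_eq_zero_of_exists (hc.imp fun _ => Exists.imp fun _ => weight20_of_not_ice)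
  simp only [EdgeConfig.prod_value_nodeWeight]
  calc Z20 n η lam μ .hor w.τ + w.g * Z20 n η lam μ .diag w.τ
    _ = ∑ c : EdgeConfig n with c.IsTwentyV,
        c.exitProd w.τ w.g * ∏ x, ∏ y, (c.vertex x y).weight20 w.nodeWeights := by
      simp only [Z20, Z20At, hω, sum_sum_filter_mul]
      rw [Finset.mul_sum, ← Finset.sum_add_distrib]
      refine Finset.sum_congr rfl fun c hc => ?_
      rw [← ((Finset.mem_filter_univ _).1 hc).isDomainWall.sum_hitsRight hn]
      ring
    _ = ∑ c : EdgeConfig n with c.Boundary (diagBoundary n),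
        c.exitProd w.τ w.g * ∏ x, ∏ y, (c.vertex x y).weight20 w.nodeWeights := by
      refine Finset.sum_subset (Finset.monotone_filter_right _ fun c _ hc =>
        (EdgeConfig.isTwentyV_iff.1 hc).1) fun c hB hc => ?_
      rw [Finset.mem_filter_univ] at hB hc
      rw [vanish c hB hc, mul_zero]

namespace Weights

/-- The weights of a node of the 6V model, on which a diagonal line has no influence. -/
def sixWeight (w : Weights) (n x : ℕ) (W S I E N O : Bool) : ℂ :=
  if O = I then w.hvWeight n x W S E N else 0

theorem transfer_sixWeight (w : Weights) : transfer (w.sixWeight n) = w.hv n := by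
  refine funext fun u => LinearMap.ext fun φ => funext fun s => ?_
  rw [transfer, nodeOp_apply, hv, crossOp_apply]
  refine Finset.sum_congr rfl fun p _ => Finset.sum_congr rfl fun q _ => ?_
  have s_diag : update (update s (.h u.2) p) (.v u.1) q (.d (u.1 + u.2 + 1))
      = s (.d (u.1 + u.2 + 1)) := by simp
  rw [Finset.sum_eq_single (s (.d (u.1 + u.2 + 1)))]
  · rw [← s_diag, update_eq_self, s_diag, sixWeight, if_pos rfl]
  · intro r _ h
    rw [sixWeight, if_neg h, zero_mul]
  · simp

end Weights

namespace EdgeConfig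

theorem prod_value_sixWeight (hc : c.SquareDWBC) (hd : ∀ i j, c.d i j = false) {w : Weights}
    {σ : ℂ} (hbL : w.bL = σ * w.b) :
    ∏ x, ∏ y, (c.vertex x y).value (w.sixWeight n x)
      = c.exitProd σ 1 * ∏ x, ∏ y, (c.vertex x y).weight6 w.a w.b w.c := by
  simp only [exitProd, ← Finset.prod_mul_distrib]
  refine Finset.prod_congr rfl fun x _ => Finset.prod_congr rfl fun y _ => ?_
  simp only [Vertex.value, Weights.sixWeight, vertex, Weights.hvWeight, horVert, Vertex.weight6,
    exitFactor, hbL, hd, if_true]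
  by_cases hx : x.val + 1 = n
  · have hl : x.succ = Fin.last n := Fin.ext hx
    rw [if_pos hx, if_pos hx, hl, hc.right y]
    cases c.h x.castSucc y <;> cases c.v x y.succ <;> cases c.v x y.castSucc <;> simp [weight6]
  · rw [if_neg hx, if_neg hx, one_mul]

/-- The configuration with the occupations of the diagonals `k` with `δ k = true` reversed. -/
def flipDiag (δ : ℕ → Bool) (c : EdgeConfig n) : EdgeConfig n where
  h := c.h
  v := c.v
  d i j := xor (c.d i j) (δ (i + j))

theorem flipDiag_flipDiag (δ : ℕ → Bool) (c : EdgeConfig n) : (c.flipDiag δ).flipDiag δ = c := by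
  simp [flipDiag]

theorem value_sixWeight_flipDiag (δ : ℕ → Bool) (w : Weights) (x y : Fin n) :
    ((c.flipDiag δ).vertex x y).value (w.sixWeight n x)
      = (c.vertex x y).value (w.sixWeight n x) := by
  have diagonal : x.val + 1 + y = x + (y + 1) := by omega
  simp only [Vertex.value, Weights.sixWeight, vertex, flipDiag, Fin.val_castSucc, Fin.val_succ,
    diagonal, Bool.bne_left_inj]
  congr

open scoped Classical in
theorem sum_boundary_sixWeight (δ : ℕ → Bool) (w : Weights) :
    ∑ c : EdgeConfig n with c.Boundary δ, ∏ x, ∏ y, (c.vertex x y).value (w.sixWeight n x)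
      = ∑ c : EdgeConfig n with c.Boundary fun _ => false,
          ∏ x, ∏ y, (c.vertex x y).value (w.sixWeight n x) := by
  refine Finset.sum_nbij' (flipDiag δ) (flipDiag δ) (fun c hc => ?_) (fun c hc => ?_)
    (fun c _ => flipDiag_flipDiag δ c) (fun c _ => flipDiag_flipDiag δ c)
    fun c _ => by simp only [value_sixWeight_flipDiag]
  all_goals
    rw [Finset.mem_filter_univ] at hc ⊢
    exact ⟨⟨hc.square.left, hc.square.right, hc.square.bottom, hc.square.top⟩,
      fun i j hij => by simp [flipDiag, hc.diag i j hij]⟩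

theorem Boundary.no_diag (hc : c.Boundary fun _ => false)
    (h : ∀ x y, (c.vertex x y).out .diag = (c.vertex x y).inc .diag) (i j : Fin (n + 1)) :
    c.d i j = false := by
  induction i using Fin.induction generalizing j with
  | zero => exact hc.diag _ _ (by simp)
  | succ x ih =>
    cases j using Fin.lastCases with
    | last => exact hc.diag _ _ (by simp)
    | cast y => exact (h x y).trans (ih y.succ)

theorem prod_value_sixWeight_eq_zero (hB : c.Boundary fun _ => false) (hc : ¬ c.IsSixV)
    {w : Weights} {σ : ℂ} (hbL : w.bL = σ * w.b) :
    ∏ x, ∏ y, (c.vertex x y).value (w.sixWeight n x) = 0 := by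
  by_cases h : ∀ x y, (c.vertex x y).out .diag = (c.vertex x y).inc .diag
  · have ice : ¬ ∀ x y, (c.vertex x y).Ice := fun ice => hc ⟨ice, hB.square, hB.no_diag h⟩
    simp only [not_forall] at ice
    rw [prod_value_sixWeight hB.square (hB.no_diag h) hbL, prod_prod_eq_zero_of_exists, mul_zero]
    exact ice.imp fun x => Exists.imp fun y hxy => weight6_of_not_ice hxy (h x y)
  · simp only [not_forall] at h
    exact prod_prod_eq_zero_of_exists (h.imp fun _ => Exists.imp fun _ hxy => if_neg hxy)

end EdgeConfig

open scoped Classical in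
theorem Z6_eq_sum_boundary (hn : 0 < n) {w : Weights} {η lam σ : ℂ} (ha : w.a = a6 η lam)
    (hb : w.b = b6 η lam) (hc : w.c = c6 η) (hbL : w.bL = σ * w.b) :
    Z6 n η lam σ = ∑ c : EdgeConfig n with c.Boundary fun _ => false,
      ∏ x, ∏ y, (c.vertex x y).value (w.sixWeight n x) := by
  calc Z6 n η lam σ
    _ = ∑ c : EdgeConfig n with c.IsSixV, ∏ x, ∏ y, (c.vertex x y).value (w.sixWeight n x) := by
      simp only [Z6, Z6At, ← ha, ← hb, ← hc, sum_sum_filter_mul]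
      refine Finset.sum_congr rfl fun c hc => ?_
      rw [Finset.mem_filter_univ] at hc
      rw [hc.isDomainWall.sum_exists_hitsRight hn,
        EdgeConfig.prod_value_sixWeight hc.square hc.no_diag hbL, mul_comm]
    _ = ∑ c : EdgeConfig n with c.Boundary fun _ => false,
        ∏ x, ∏ y, (c.vertex x y).value (w.sixWeight n x) := by
      refine Finset.sum_subset (Finset.monotone_filter_right _ fun c _ hc =>
        ⟨hc.square, fun i j _ => hc.no_diag i j⟩) fun c hB hc => ?_
      rw [Finset.mem_filter_univ] at hB hc
      exact EdgeConfig.prod_value_sixWeight_eq_zero hB hc hbL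

theorem Z20_add_eq_Z6 (hn : 0 < n) {w : Weights} (hw : w.Compatible) {η lam μ σ : ℂ}
    (hω : omega η lam μ = w.nodeWeights) (ha : w.a = a6 η lam) (hb : w.b = b6 η lam)
    (hc : w.c = c6 η) (hbL : w.bL = σ * w.b) :
    Z20 n η lam μ .hor w.τ + w.g * Z20 n η lam μ .diag w.τ
      = (w.a₂ * w.a₃) ^ n ^ 2 * Z6 n η lam σ := by
  classical
  rw [Z20_add_eq_sum_boundary hn w hω, EdgeConfig.sum_boundary_prod_value,
    show transfer (w.nodeWeight n) = w.node n from rfl, hw.prod_node_apply,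
    Z6_eq_sum_boundary hn ha hb hc hbL, ← EdgeConfig.sum_boundary_sixWeight (diagBoundary n) w,
    EdgeConfig.sum_boundary_prod_value, w.transfer_sixWeight]

end RefinedSums

section Sines

open Complex

theorem sin_add_mul_sin_add_left (A B e : ℂ) :
    sin (A + B) * sin (A + e) = sin (A + B + e) * sin A + sin e * sin B := by
  simp only [sin_add, cos_add]
  linear_combination (sin e * sin B) * sin_sq_add_cos_sq A

theorem sin_add_mul_sin_add_right (A B e : ℂ) :
    sin (A + e) * sin (B + e) = sin A * sin B + sin e * sin (A + B + e) := by
  simp only [sin_add, cos_add]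
  linear_combination (sin A * sin B) * sin_sq_add_cos_sq e

theorem sin_sub_mul_sin_add (A e : ℂ) :
    sin (A - e) * sin (A + e) = sin A ^ 2 - sin e ^ 2 := by
  simp only [sin_add, sin_sub]
  linear_combination sin A ^ 2 * sin_sq_add_cos_sq e - sin e ^ 2 * sin_sq_add_cos_sq A

theorem exp_sub_exp (x y : ℂ) :
    exp (I * x) - exp (I * y) = 2 * I * exp (I * ((x + y) / 2)) * sin ((x - y) / 2) := by
  have hx : exp (I * x) = exp (I * ((x + y) / 2)) * exp (((x - y) / 2) * I) := by
    rw [← exp_add]; ring_nf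
  have hy : exp (I * y) = exp (I * ((x + y) / 2)) * exp (-((x - y) / 2) * I) := by
    rw [← exp_add]; ring_nf
  rw [hx, hy, sin]
  linear_combination exp (I * ((x + y) / 2)) * (exp (((x - y) / 2) * I)
    - exp (-((x - y) / 2) * I)) * I_sq

theorem a2_eq (η lam μ : ℂ) : a2 η lam μ
    = exp (I * ((lam + η + μ) / 2)) / tCbrt μ * sin ((lam + 3 * η - μ) / 2) := by
  have ht : tCbrt μ ≠ 0 := exp_ne_zero _
  have difference : qPar η * zPar η lam - (qPar η)⁻¹ * tPar μ
      = exp (I * (lam + 2 * η)) - exp (I * (μ - η)) := by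
    simp only [qPar, zPar, tPar, ← exp_neg, ← exp_add]
    ring_nf
  rw [a2, nuPar, difference, exp_sub_exp,
    show (lam + 2 * η + (μ - η)) / 2 = (lam + η + μ) / 2 by ring,
    show (lam + 2 * η - (μ - η)) / 2 = (lam + 3 * η - μ) / 2 by ring]
  field_simp [I_ne_zero]

theorem a3_eq (η lam μ : ℂ) : a3 η lam μ
    = exp (I * ((μ - lam - η) / 2)) / tCbrt μ * sin ((lam + 3 * η + μ) / 2) := by
  have ht : tCbrt μ ≠ 0 := exp_ne_zero _
  have difference : qPar η * tPar μ - (qPar η)⁻¹ * wPar η lam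
      = exp (I * (μ + η)) - exp (I * (-lam - 2 * η)) := by
    simp only [qPar, wPar, tPar, ← exp_neg, ← exp_add]
    ring_nf
  rw [a3, nuPar, difference, exp_sub_exp,
    show (μ + η + (-lam - 2 * η)) / 2 = (μ - lam - η) / 2 by ring,
    show (μ + η - (-lam - 2 * η)) / 2 = (lam + 3 * η + μ) / 2 by ring]
  field_simp [I_ne_zero]

theorem a2_mul_a3_div (η lam μ : ℂ) : a2 η lam μ * a3 η lam μ / tCbrt μ
    = sin ((lam + 3 * η - μ) / 2) * sin ((lam + 3 * η + μ) / 2) := by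
  have ht : tCbrt μ ≠ 0 := exp_ne_zero _
  have phases : exp (I * ((lam + η + μ) / 2)) * exp (I * ((μ - lam - η) / 2)) = tCbrt μ ^ 3 := by
    rw [tCbrt, ← exp_nat_mul, ← exp_add]
    congr 1
    push_cast
    ring
  rw [a2_eq, a3_eq, mul_mul_mul_comm, div_mul_div_comm, phases]
  field_simp

/-- The weights of the theorem. Those of the last column that are not prescribed, `b₃L` and `c₃L`,
solve the linear system formed by the relations `horL` and `prodL`. -/
noncomputable def sinWeights (η lam μ σ : ℂ) : Weights where
  a := a6 η lam
  b := b6 η lam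
  c := c6 η
  a₂ := sin ((lam + 3 * η - μ) / 2)
  b₂ := sin ((lam - η - μ) / 2)
  a₃ := sin ((lam + 3 * η + μ) / 2)
  b₃ := sin ((lam - η + μ) / 2)
  bL := σ * b6 η lam
  b₃L := sin ((lam + 3 * η + μ) / 2) * (σ * sin (lam - η) * sin ((lam + 3 * η - μ) / 2)
    - sin (lam + η) * sin ((lam - η - μ) / 2)) / den η lam μ σ
  c₃L := sin ((lam + 3 * η + μ) / 2) * sin (2 * η) ^ 2 / den η lam μ σ
  τ := tau η lam μ σ
  g := gFun η lam μ σ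

theorem compatible_sinWeights {η lam μ σ : ℂ} (hden : den η lam μ σ ≠ 0)
    (hsin : sin ((lam - η + μ) / 2) ≠ 0) : (sinWeights η lam μ σ).Compatible where
  hor := by
    simp only [sinWeights, a6, b6, c6]
    convert sin_add_mul_sin_add_left ((lam - η - μ) / 2) ((lam - η + μ) / 2) (2 * η) using 3 <;>
      ring_nf
  vert := by
    simp only [sinWeights, a6, b6, c6]
    convert sin_add_mul_sin_add_left ((lam - η + μ) / 2) ((lam - η - μ) / 2) (2 * η) using 3 <;>
      ring_nf
  prod := by
    simp only [sinWeights, a6, b6, c6]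
    convert sin_add_mul_sin_add_right ((lam - η - μ) / 2) ((lam - η + μ) / 2) (2 * η) using 3 <;>
      ring_nf
  horL := by
    simp only [sinWeights, a6, b6, c6]
    field_simp
    ring
  prodL := by
    have shift : sin ((lam - 5 * η - μ) / 2) * sin ((lam + 3 * η - μ) / 2)
        = sin ((lam - η - μ) / 2) ^ 2 - sin (2 * η) ^ 2 := by
      convert sin_sub_mul_sin_add ((lam - η - μ) / 2) (2 * η) using 3 <;> ring_nf
    simp only [sinWeights, a6, b6, c6]
    rw [mul_div_assoc', mul_div_assoc', ← add_div, eq_div_iff hden, den]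
    linear_combination -sin (2 * η) * sin ((lam + 3 * η + μ) / 2) * sin (lam + η) * shift
  tau_eq := by
    simp only [sinWeights, b6, tau]
    field_simp
  g_eq := by
    simp only [sinWeights, b6, c6, gFun]
    field_simp

end Sines

end TwentyVertex

theorem theorem3p1 (n : ℕ) (η lam μ σ : ℂ)
    (hden : TwentyVertex.den η lam μ σ ≠ 0)
    (hsin : Complex.sin ((lam - η + μ) / 2) ≠ 0) :
    TwentyVertex.Z20 n η lam μ .hor (TwentyVertex.tau η lam μ σ)
        + TwentyVertex.gFun η lam μ σ
          * TwentyVertex.Z20 n η lam μ .diag (TwentyVertex.tau η lam μ σ)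
      = (TwentyVertex.a2 η lam μ * TwentyVertex.a3 η lam μ / TwentyVertex.tCbrt μ) ^ (n ^ 2)
          * TwentyVertex.Z6 n η lam σ := by
  rcases Nat.eq_zero_or_pos n with rfl | hn
  · simp [TwentyVertex.Z20, TwentyVertex.Z6]
  · rw [TwentyVertex.a2_mul_a3_div]
    exact TwentyVertex.Z20_add_eq_Z6 hn (TwentyVertex.compatible_sinWeights hden hsin)
      rfl rfl rfl rfl rfl
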